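/- Let $G$ be a countable discrete abelian group, written multiplicatively, and let $\varphi\colon G\to G$ be an injective endomorphism with $1<|G/\varphi(G)|<\infty$ and $\bigcap_{n}\varphi^n(G)=\{1\}$. Let $H=\widehat G$ be the (compact) dual group of $G$, $\alpha\colon H\to H$, $\chi\mapsto\chi\circ\varphi$, the dual endomorphism, $L=\bigcup_n\operatorname{Ker}(\alpha^n)\subseteq H$, regarded as a discrete group, and let $K=\varprojlim_n G/\varphi^n(G)$ be the $\varphi$-adic completion of $G$, a compact group that contains $G$ as a dense subgroup. Write $\langle g|l\rangle=l(g)$ for $g\in G$, $l\in L$. Let $A_\varphi$ be the universal unital C*-algebra generated by an isometry $s$ and unitaries $u_g$ ($g\in G$) with the relations $$u_gu_h=u_{gh},\qquad su_g=u_{\varphi(g)}s,\qquad \sum_{x\in G/\varphi(G)}u_xss^*u_x^*=1 .$$ (1) There are injective unital $*$-homomorphisms $j_H\colon C(H)\to A_\varphi$, $j_K\colon C(K)\to A_\varphi$, $j_G\colon C^*(G)\to A_\varphi$, $j_L\colon C^*(L)\to A_\varphi$ as follows. The map $j_H$ sends the character $\chi\mapsto\chi(g)$ of $H$ to $u_g$,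 and $j_G$ sends the canonical unitary of $g\in G$ to $u_g$; both have as range the C*-subalgebra generated by all $u_g$. The map $j_K$ sends, for $n\ge 0$ and $g\in G$, the characteristic function of $\{k\in K: k_n=g\varphi^n(G)\}$ to $u_gs^ns^{*n}u_g^*$, and $j_L$ sends the canonical unitary of $l\in L$ to $w_l:=j_K(f_l)$, where $f_l\in C(K)$ is the continuous function with $f_l(g)=\overline{\langle g|l\rangle}$ for $g\in G$; both have as range the C*-subalgebra generated by all $u_gs^ns^{*n}u_g^*$. (2) Let $B_\varphi\subseteq A_\varphi$ be the C*-subalgebra generated by the copies of $C(H)$ and $C(K)$ from (1), or equivalently by those of $C^*(G)$ and $C^*(L)$. Then $B_\varphi$ is isomorphic to the crossed product $C(K)\rtimes G$ for the action of $G$ on $K$ by translation, $(g\cdot f)(k)=f(g^{-1}k)$, by an isomorphism that is $j_K$ on $C(K)$ and sends the canonical unitary of $g$ to $u_g$. (3) $B_\varphi$ is simple (it is non-zero and its only closed two-sided ideals are $0$ and $B_\varphi$) and has a unique trace (a positive linear functional $\tau$ with $\tau(1)=1$ and $\tau(xy)=\tau(yx)$). (4) Moreover $$B_\varphi\;\cong\;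 C^*(L)\rtimes G\;\cong\; C^*(G)\rtimes L\;\cong\; C(H)\rtimes L .$$ Here $G$ acts on $C^*(L)$ by multiplying the canonical unitary of $l$ by $\langle g|l\rangle$, $L$ acts on $C^*(G)$ by multiplying the canonical unitary of $g$ by $\overline{\langle g|l\rangle}$ (both actions express $u_gw_l=\langle g|l\rangle w_lu_g$), and $L\subseteq H$ acts on $C(H)$ by translation, $(l\cdot f)(\chi)=f(l^{-1}\chi)$. The isomorphisms of these three crossed products with $B_\varphi$ can be chosen to be $j_L$, $j_G$, $j_H$, respectively, on the coefficient algebras and to send the canonical group unitaries to $u_g$, respectively $w_l$. -/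

import Mathlib

namespace EndoAlg

noncomputable section

/-! ## The free unital `*`-algebra on a set of generators -/

/-- The free complex unital `*`-algebra on `X`: noncommutative polynomials in the letters
`x = (x, false)` and `x* = (x, true)`. -/
def FreeStarAlgebra (X : Type*) : Type _ := FreeAlgebra ℂ (X × Bool)

namespace FreeStarAlgebra

variable {X : Type*}

instance : Ring (FreeStarAlgebra X) := inferInstanceAs (Ring (FreeAlgebra ℂ (X × Bool)))
instance : Algebra ℂ (FreeStarAlgebra X) :=
  inferInstanceAs (Algebra ℂ (FreeAlgebra ℂ (X × Bool)))

/-- The letter `x` or `x*`. -/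
def letter (y : X × Bool) : FreeStarAlgebra X := FreeAlgebra.ι ℂ y

/-- The generator attached to `x`. -/
def of (x : X) : FreeStarAlgebra X := letter (x, false)

theorem induction {motive : FreeStarAlgebra X → Prop}
    (scalar : ∀ c : ℂ, motive (algebraMap ℂ (FreeStarAlgebra X) c))
    (letter : ∀ y, motive (letter y))
    (mul : ∀ a b, motive a → motive b → motive (a * b))
    (add : ∀ a b, motive a → motive b → motive (a + b)) (a : FreeStarAlgebra X) : motive a :=
  FreeAlgebra.induction (R := ℂ) (X := X × Bool) (motive := motive) scalar letter mul add a

/-- Complex conjugation of all coefficients, fixing the letters. -/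
def conjHom : FreeStarAlgebra X →+* FreeStarAlgebra X :=
  ((FreeAlgebra.equivMonoidAlgebraFreeMonoid (R := ℂ) (X := X × Bool)).symm.toRingEquiv.toRingHom.comp
    (MonoidAlgebra.mapRingHom (FreeMonoid (X × Bool)) (starRingEnd ℂ))).comp
    (FreeAlgebra.equivMonoidAlgebraFreeMonoid (R := ℂ) (X := X × Bool)).toRingEquiv.toRingHom

/-- The linear antimultiplicative map exchanging `x` and `x*`. -/
def flipHom : FreeStarAlgebra X →ₐ[ℂ] (FreeStarAlgebra X)ᵐᵒᵖ :=
  FreeAlgebra.lift ℂ (fun y : X × Bool => MulOpposite.op (letter (y.1, !y.2)))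

theorem conjHom_algebraMap (c : ℂ) :
    conjHom (algebraMap ℂ (FreeStarAlgebra X) c) = algebraMap ℂ _ (starRingEnd ℂ c) := by
  change (FreeAlgebra.equivMonoidAlgebraFreeMonoid (R := ℂ) (X := X × Bool)).symm
    (MonoidAlgebra.mapRingHom (FreeMonoid (X × Bool)) (starRingEnd ℂ)
      ((FreeAlgebra.equivMonoidAlgebraFreeMonoid (R := ℂ) (X := X × Bool))
        (algebraMap ℂ (FreeAlgebra ℂ (X × Bool)) c))) = _
  rw [AlgEquiv.commutes]
  simp only [MonoidAlgebra.coe_algebraMap, Function.comp, MonoidAlgebra.mapRingHom_single]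
  exact AlgEquiv.commutes (FreeAlgebra.equivMonoidAlgebraFreeMonoid (R := ℂ) (X := X × Bool)).symm
    (starRingEnd ℂ c)

theorem conjHom_letter (y : X × Bool) : conjHom (letter y) = letter y := by
  change (FreeAlgebra.equivMonoidAlgebraFreeMonoid (R := ℂ) (X := X × Bool)).symm
    (MonoidAlgebra.mapRingHom (FreeMonoid (X × Bool)) (starRingEnd ℂ)
      ((FreeAlgebra.equivMonoidAlgebraFreeMonoid (R := ℂ) (X := X × Bool))
        (FreeAlgebra.ι ℂ y))) = FreeAlgebra.ι ℂ y
  simp [FreeAlgebra.equivMonoidAlgebraFreeMonoid]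

theorem flipHom_letter (y : X × Bool) :
    flipHom (letter y) = MulOpposite.op (letter (y.1, !y.2)) :=
  FreeAlgebra.lift_ι_apply _ _

instance : Star (FreeStarAlgebra X) := ⟨fun a => (flipHom (conjHom a)).unop⟩

theorem star_def (a : FreeStarAlgebra X) : star a = (flipHom (conjHom a)).unop := rfl

theorem star_letter (y : X × Bool) : star (letter y) = letter (y.1, !y.2) := by
  rw [star_def, conjHom_letter, flipHom_letter, MulOpposite.unop_op]

theorem star_scalar (c : ℂ) :
    star (algebraMap ℂ (FreeStarAlgebra X) c) = algebraMap ℂ _ (starRingEnd ℂ c) := by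
  rw [star_def, conjHom_algebraMap, AlgHom.commutes]; rfl

theorem star_mul_aux (a b : FreeStarAlgebra X) : star (a * b) = star b * star a := by
  simp [star_def, map_mul]

theorem star_add_aux (a b : FreeStarAlgebra X) : star (a + b) = star a + star b := by
  simp [star_def, map_add]

instance : StarRing (FreeStarAlgebra X) where
  star_involutive a := by
    induction a using induction with
    | scalar c => rw [star_scalar, star_scalar]; simp
    | letter y => rw [star_letter, star_letter]; simp
    | mul a b ha hb => rw [star_mul_aux, star_mul_aux, ha, hb]
    | add a b ha hb => rw [star_add_aux, star_add_aux, ha, hb]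
  star_mul := star_mul_aux
  star_add := star_add_aux

instance : StarModule ℂ (FreeStarAlgebra X) where
  star_smul c a := by
    rw [Algebra.smul_def, Algebra.smul_def, star_mul, star_scalar, Algebra.commutes]; rfl

/-- The `*`-homomorphism on the free `*`-algebra given by the images of the generators. -/
def lift {C : Type*} [Ring C] [StarRing C] [Algebra ℂ C] [StarModule ℂ C] (f : X → C) :
    FreeStarAlgebra X →⋆ₐ[ℂ] C :=
  let F : FreeStarAlgebra X →ₐ[ℂ] C :=
    FreeAlgebra.lift ℂ (fun y : X × Bool => if y.2 then star (f y.1) else f y.1)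
  have hF : ∀ y, F (letter y) = if y.2 then star (f y.1) else f y.1 :=
    fun y => FreeAlgebra.lift_ι_apply _ _
  { F with
    map_star' := fun a => by
      change F (star a) = star (F a)
      induction a using induction with
      | scalar c =>
        rw [star_scalar, AlgHom.commutes, AlgHom.commutes]; exact algebraMap_star_comm c
      | letter y => rw [star_letter, hF, hF]; cases y.2 <;> simp
      | mul a b ha hb => rw [star_mul, map_mul, map_mul, star_mul, ha, hb]
      | add a b ha hb => rw [star_add, map_add, map_add, star_add, ha, hb] }

theorem lift_of {C : Type*} [Ring C] [StarRing C] [Algebra ℂ C] [StarModule ℂ C] (f : X → C)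
    (x : X) : lift f (of x) = f x :=
  (FreeAlgebra.lift_ι_apply _ _).trans (by simp)

end FreeStarAlgebra

/-! ## Universal C*-algebras given by generators and relations -/

/-- A C*-seminorm on a complex `*`-algebra. -/
structure CStarSeminorm (R : Type*) [Ring R] [StarRing R] [Algebra ℂ R] extends
    Seminorm ℂ R where
  mul_le' : ∀ a b, toFun (a * b) ≤ toFun a * toFun b
  star_mul_self' : ∀ a, toFun (star a * a) = toFun a * toFun a

namespace CStarSeminorm

variable {R : Type*} [Ring R] [StarRing R] [Algebra ℂ R] (p : CStarSeminorm R)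

theorem mul_le (a b : R) : p.toSeminorm (a * b) ≤ p.toSeminorm a * p.toSeminorm b := p.mul_le' a b

theorem star_mul_self (a : R) :
    p.toSeminorm (star a * a) = p.toSeminorm a * p.toSeminorm a := p.star_mul_self' a

theorem star_eq (a : R) : p.toSeminorm (star a) = p.toSeminorm a := by
  have key : ∀ b, p.toSeminorm b ≤ p.toSeminorm (star b) := by
    intro b
    have h := p.mul_le (star b) b
    rw [p.star_mul_self] at h
    rcases (apply_nonneg p.toSeminorm b).eq_or_lt with h0 | h0
    · rw [← h0]; exact apply_nonneg _ _
    · exact le_of_mul_le_mul_right h h0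
  exact le_antisymm (by simpa using key (star a)) (key a)

theorem one_le : p.toSeminorm 1 ≤ 1 := by
  have h := p.star_mul_self 1
  rw [star_one, one_mul] at h
  nlinarith [sq_nonneg (p.toSeminorm 1 - 1)]

/-- The C*-seminorm `‖π(·)‖` of a `*`-homomorphism `π` into a C*-algebra. -/
def ofHom {C : Type*} [CStarAlgebra C] (π : R →⋆ₐ[ℂ] C) : CStarSeminorm R where
  toFun a := ‖π a‖
  map_zero' := by simp
  add_le' a b := by simpa using norm_add_le (π a) (π b)
  neg' a := by simp
  smul' c a := by simp [norm_smul]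
  mul_le' a b := by simpa using norm_mul_le (π a) (π b)
  star_mul_self' a := by simp [map_star, CStarRing.norm_star_mul_self]

end CStarSeminorm

section Universal

open FreeStarAlgebra

variable {X : Type*} (b : X → NNReal) (r : FreeStarAlgebra X → FreeStarAlgebra X → Prop)

/-- The C*-seminorms on the free `*`-algebra for which the relations `x = y` (for `r x y`) and
the norm bounds `‖x‖ ≤ b x` on the generators hold. -/
def AdmissibleSeminorm : Type _ :=
  {p : CStarSeminorm (FreeStarAlgebra X) //
    (∀ x, p.toSeminorm (of x) ≤ b x) ∧ ∀ x y, r x y → p.toSeminorm (x - y) = 0}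

/-- The supremum of all admissible C*-seminorms. -/
def maxNorm (a : FreeStarAlgebra X) : ℝ := ⨆ p : AdmissibleSeminorm b r, p.1.toSeminorm a

theorem bddAbove_admissible (a : FreeStarAlgebra X) :
    BddAbove (Set.range fun p : AdmissibleSeminorm b r => p.1.toSeminorm a) := by
  suffices h : ∃ M : ℝ, 0 ≤ M ∧ ∀ p : AdmissibleSeminorm b r, p.1.toSeminorm a ≤ M by
    obtain ⟨M, -, hM⟩ := h
    exact ⟨M, by rintro _ ⟨p, rfl⟩; exact hM p⟩
  induction a using FreeStarAlgebra.induction with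
  | scalar c =>
    refine ⟨‖c‖, norm_nonneg _, fun p => ?_⟩
    rw [Algebra.algebraMap_eq_smul_one, map_smul_eq_mul]
    exact mul_le_of_le_one_right (norm_nonneg _) p.1.one_le
  | letter y =>
    obtain ⟨x, s⟩ := y
    refine ⟨b x, (b x).2, fun p => ?_⟩
    cases s with
    | false => exact p.2.1 x
    | true =>
      have : letter (x, true) = star (of x) := by rw [of, star_letter]; rfl
      rw [this, p.1.star_eq]; exact p.2.1 x
  | mul a c ha hc =>
    obtain ⟨M, hM0, hM⟩ := ha
    obtain ⟨N, hN0, hN⟩ := hc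
    exact ⟨M * N, mul_nonneg hM0 hN0, fun p => (p.1.mul_le a c).trans
      (mul_le_mul (hM p) (hN p) (apply_nonneg _ _) hM0)⟩
  | add a c ha hc =>
    obtain ⟨M, hM0, hM⟩ := ha
    obtain ⟨N, hN0, hN⟩ := hc
    exact ⟨M + N, add_nonneg hM0 hN0, fun p => (map_add_le_add p.1.toSeminorm a c).trans
      (add_le_add (hM p) (hN p))⟩

theorem le_maxNorm (p : AdmissibleSeminorm b r) (a : FreeStarAlgebra X) :
    p.1.toSeminorm a ≤ maxNorm b r a :=
  le_ciSup (bddAbove_admissible b r a) p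

theorem maxNorm_nonneg (a : FreeStarAlgebra X) : 0 ≤ maxNorm b r a :=
  Real.iSup_nonneg fun p => apply_nonneg p.1.toSeminorm a

theorem maxNorm_le {a : FreeStarAlgebra X} {M : ℝ} (hM : 0 ≤ M)
    (h : ∀ p : AdmissibleSeminorm b r, p.1.toSeminorm a ≤ M) : maxNorm b r a ≤ M :=
  Real.iSup_le h hM

/-- The largest admissible C*-seminorm. -/
def maxSeminorm : CStarSeminorm (FreeStarAlgebra X) where
  toFun := maxNorm b r
  map_zero' := by simp [maxNorm]
  add_le' a c := maxNorm_le b r (add_nonneg (maxNorm_nonneg b r a) (maxNorm_nonneg b r c))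
    fun p => (map_add_le_add p.1.toSeminorm a c).trans
      (add_le_add (le_maxNorm b r p a) (le_maxNorm b r p c))
  neg' a := by simp [maxNorm]
  smul' c a := by
    simp only [maxNorm, map_smul_eq_mul]
    exact (Real.mul_iSup_of_nonneg (norm_nonneg c) _).symm
  mul_le' a c := maxNorm_le b r (mul_nonneg (maxNorm_nonneg b r a) (maxNorm_nonneg b r c))
    fun p => (p.1.mul_le a c).trans
      (mul_le_mul (le_maxNorm b r p a) (le_maxNorm b r p c) (apply_nonneg _ _)
        (maxNorm_nonneg b r a))
  star_mul_self' a := by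
    refine le_antisymm (maxNorm_le b r
      (mul_nonneg (maxNorm_nonneg b r a) (maxNorm_nonneg b r a)) fun p => ?_) ?_
    · rw [p.1.star_mul_self]
      exact mul_le_mul (le_maxNorm b r p a) (le_maxNorm b r p a) (apply_nonneg _ _)
        (maxNorm_nonneg b r a)
    · have h : maxNorm b r a ≤ Real.sqrt (maxNorm b r (star a * a)) :=
        maxNorm_le b r (Real.sqrt_nonneg _) fun p => Real.le_sqrt_of_sq_le (by
          rw [sq, ← p.1.star_mul_self]; exact le_maxNorm b r p _)
      calc maxNorm b r a * maxNorm b r a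
          ≤ Real.sqrt (maxNorm b r (star a * a)) * Real.sqrt (maxNorm b r (star a * a)) :=
            mul_self_le_mul_self (maxNorm_nonneg b r a) h
        _ = maxNorm b r (star a * a) := Real.mul_self_sqrt (maxNorm_nonneg b r _)

/-- The free `*`-algebra, equipped with the largest admissible C*-seminorm. -/
@[nolint unusedArguments]
def PreUniversal (_b : X → NNReal) (_r : FreeStarAlgebra X → FreeStarAlgebra X → Prop) : Type _ :=
  FreeStarAlgebra X

namespace PreUniversal

instance : Ring (PreUniversal b r) := inferInstanceAs (Ring (FreeStarAlgebra X))
instance : Algebra ℂ (PreUniversal b r) := inferInstanceAs (Algebra ℂ (FreeStarAlgebra X))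
instance : StarRing (PreUniversal b r) := inferInstanceAs (StarRing (FreeStarAlgebra X))
instance : StarModule ℂ (PreUniversal b r) := inferInstanceAs (StarModule ℂ (FreeStarAlgebra X))

instance : SeminormedRing (PreUniversal b r) :=
  RingSeminorm.toSeminormedRing (R := PreUniversal b r)
    { (maxSeminorm b r).toSeminorm.toAddGroupSeminorm with
      mul_le' := (maxSeminorm b r).mul_le' }

theorem norm_def (a : PreUniversal b r) : ‖a‖ = maxNorm b r a := rfl

instance : NormedAlgebra ℂ (PreUniversal b r) where
  norm_smul_le c a := (map_smul_eq_mul (maxSeminorm b r).toSeminorm c a).le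

instance : NormedStarGroup (PreUniversal b r) where
  norm_star_le a := ((maxSeminorm b r).star_eq a).le

end PreUniversal

/-- The universal unital C*-algebra with generators `x : X`, relations `r` and norm bounds `b`:
the (Hausdorff) completion of the free `*`-algebra in its largest admissible C*-seminorm. -/
def UniversalCStar : Type _ := UniformSpace.Completion (PreUniversal b r)

namespace UniversalCStar

open UniformSpace

instance : NormedRing (UniversalCStar b r) :=
  inferInstanceAs (NormedRing (Completion (PreUniversal b r)))
instance : CompleteSpace (UniversalCStar b r) :=
  inferInstanceAs (CompleteSpace (Completion (PreUniversal b r)))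
instance : Algebra ℂ (UniversalCStar b r) :=
  inferInstanceAs (Algebra ℂ (Completion (PreUniversal b r)))
instance : NormedSpace ℂ (UniversalCStar b r) :=
  inferInstanceAs (NormedSpace ℂ (Completion (PreUniversal b r)))
instance : NormedAlgebra ℂ (UniversalCStar b r) where
  norm_smul_le := norm_smul_le (α := ℂ) (β := UniversalCStar b r)

/-- The canonical map from the free `*`-algebra. -/
def mk (a : FreeStarAlgebra X) : UniversalCStar b r :=
  Completion.coe' (α := PreUniversal b r) a

theorem induction_on {motive : UniversalCStar b r → Prop} (a : UniversalCStar b r)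
    (closed : IsClosed {x | motive x}) (mk : ∀ a, motive (mk b r a)) : motive a :=
  Completion.induction_on (p := motive) a closed mk

theorem norm_mk (a : FreeStarAlgebra X) : ‖mk b r a‖ = maxNorm b r a :=
  Completion.norm_coe (E := PreUniversal b r) a

theorem mk_mul (a c : FreeStarAlgebra X) : mk b r (a * c) = mk b r a * mk b r c :=
  Completion.coe_mul (α := PreUniversal b r) a c
theorem mk_add (a c : FreeStarAlgebra X) : mk b r (a + c) = mk b r a + mk b r c :=
  Completion.coe_add (α := PreUniversal b r) a c
theorem mk_smul (c : ℂ) (a : FreeStarAlgebra X) : mk b r (c • a) = c • mk b r a :=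
  Completion.coe_smul (M := ℂ) (X := PreUniversal b r) c a
theorem mk_one : mk b r 1 = 1 := Completion.coe_one (PreUniversal b r)

instance : Star (UniversalCStar b r) :=
  ⟨Completion.map (star : PreUniversal b r → PreUniversal b r)⟩

theorem continuous_star' : Continuous (star : UniversalCStar b r → UniversalCStar b r) :=
  Completion.continuous_map (α := PreUniversal b r) (β := PreUniversal b r)

theorem mk_star (a : FreeStarAlgebra X) : mk b r (star a) = star (mk b r a) :=
  (Completion.map_coe (α := PreUniversal b r) (β := PreUniversal b r)
    (f := star) (starNormedAddGroupHom (E := PreUniversal b r)).uniformContinuous a).symm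

instance : InvolutiveStar (UniversalCStar b r) where
  star_involutive a := by
    have hs := continuous_star' b r
    induction a using induction_on with
    | closed =>
      exact isClosed_eq (hs.comp hs) continuous_id
    | mk a => rw [← mk_star, ← mk_star, star_star]

instance : StarRing (UniversalCStar b r) where
  star_mul a c := by
    have hs := continuous_star' b r
    induction a using induction_on with
    | closed =>
      exact isClosed_eq (hs.comp (continuous_id.mul continuous_const)) (continuous_const.mul hs)
    | mk a =>
      induction c using induction_on with
      | closed =>
        exact isClosed_eq (hs.comp (continuous_const.mul continuous_id)) (hs.mul continuous_const)
      | mk c => rw [← mk_mul, ← mk_star, ← mk_star, ← mk_star, star_mul, mk_mul]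
  star_add a c := by
    have hs := continuous_star' b r
    induction a using induction_on with
    | closed =>
      exact isClosed_eq (hs.comp (continuous_id.add continuous_const)) (hs.add continuous_const)
    | mk a =>
      induction c using induction_on with
      | closed =>
        exact isClosed_eq (hs.comp (continuous_const.add continuous_id)) (continuous_const.add hs)
      | mk c => rw [← mk_add, ← mk_star, ← mk_star, ← mk_star, star_add, mk_add]

instance : StarModule ℂ (UniversalCStar b r) where
  star_smul c a := by
    have hs := continuous_star' b r
    induction a using induction_on with
    | closed =>
      exact isClosed_eq (hs.comp (continuous_const_smul c)) (hs.const_smul (star c))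
    | mk a => rw [← mk_smul, ← mk_star, ← mk_star, star_smul, mk_smul]

instance : CStarRing (UniversalCStar b r) where
  norm_mul_self_le a := by
    have hs := continuous_star' b r
    induction a using induction_on with
    | closed =>
      exact isClosed_le (continuous_norm.mul continuous_norm)
        (continuous_norm.comp (hs.mul continuous_id))
    | mk a =>
      rw [← mk_star, ← mk_mul, norm_mk, norm_mk]
      exact ((maxSeminorm b r).star_mul_self' a).ge

instance : CStarAlgebra (UniversalCStar b r) where

/-- The generator of the universal C*-algebra attached to `x`. -/
def gen (x : X) : UniversalCStar b r := mk b r (of x)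

/-- The canonical `*`-homomorphism from the free `*`-algebra. -/
def mkHom : FreeStarAlgebra X →⋆ₐ[ℂ] UniversalCStar b r where
  toFun := mk b r
  map_one' := mk_one b r
  map_mul' := mk_mul b r
  map_zero' := Completion.coe_zero (α := PreUniversal b r)
  map_add' := mk_add b r
  commutes' c := by
    rw [Algebra.algebraMap_eq_smul_one, mk_smul, mk_one, ← Algebra.algebraMap_eq_smul_one]
  map_star' := mk_star b r

/-- The relations hold in the universal C*-algebra. -/
theorem mkHom_eq_of_rel {x y : FreeStarAlgebra X} (h : r x y) :
    mkHom b r x = mkHom b r y := by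
  rw [← sub_eq_zero, ← map_sub, ← norm_eq_zero]
  refine le_antisymm ?_ (norm_nonneg _)
  exact (norm_mk b r (x - y)).le.trans (maxNorm_le b r le_rfl fun p => (p.2.2 x y h).le)

variable {b r}

/-- The ring homomorphism on the free `*`-algebra given by `f`. -/
def liftPre {C : Type*} [CStarAlgebra C] (f : X → C) : PreUniversal b r →+* C :=
  ((FreeStarAlgebra.lift f : FreeStarAlgebra X →⋆ₐ[ℂ] C) : FreeStarAlgebra X →+* C)

theorem continuous_liftPre {C : Type*} [CStarAlgebra C] (f : X → C) (hb : ∀ x, ‖f x‖ ≤ b x)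
    (hr : ∀ x y, r x y → FreeStarAlgebra.lift f x = FreeStarAlgebra.lift f y) :
    Continuous (liftPre (b := b) (r := r) f) := by
  refine AddMonoidHomClass.continuous_of_bound (liftPre (b := b) (r := r) f) 1 fun a => ?_
  rw [one_mul]
  exact le_maxNorm b r ⟨CStarSeminorm.ofHom (FreeStarAlgebra.lift f),
    fun x => (congrArg norm (FreeStarAlgebra.lift_of f x)).le.trans (hb x),
    fun x y h => by
      change ‖FreeStarAlgebra.lift f (x - y)‖ = 0
      rw [map_sub, hr x y h, sub_self, norm_zero]⟩ a

/-- The universal property: generators may be sent to any elements of a unital C*-algebra which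
satisfy the relations and the norm bounds. -/
def lift {C : Type*} [CStarAlgebra C] (f : X → C) (hb : ∀ x, ‖f x‖ ≤ b x)
    (hr : ∀ x y, r x y → FreeStarAlgebra.lift f x = FreeStarAlgebra.lift f y) :
    UniversalCStar b r →⋆ₐ[ℂ] C :=
  let E : UniversalCStar b r →+* C := Completion.extensionHom (liftPre f) (continuous_liftPre f hb hr)
  have hE : ∀ a, E (mk b r a) = FreeStarAlgebra.lift f a := fun a =>
    Completion.extensionHom_coe (liftPre f) (continuous_liftPre f hb hr) a
  have hEc : Continuous E := Completion.continuous_extension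
  { E with
    commutes' := fun c => by
      change E _ = _
      rw [← (mkHom b r).toAlgHom.commutes c]
      exact (hE _).trans ((FreeStarAlgebra.lift f).toAlgHom.commutes c)
    map_star' := fun a => by
      change E (star a) = star (E a)
      induction a using induction_on with
      | closed =>
        exact isClosed_eq (hEc.comp (continuous_star' b r)) (hEc.star)
      | mk a => rw [← mk_star, hE, hE, map_star] }

theorem lift_gen {C : Type*} [CStarAlgebra C] (f : X → C) (hb : ∀ x, ‖f x‖ ≤ b x)
    (hr : ∀ x y, r x y → FreeStarAlgebra.lift f x = FreeStarAlgebra.lift f y) (x : X) :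
    lift f hb hr (gen b r x) = f x :=
  (Completion.extensionHom_coe (liftPre f) (continuous_liftPre f hb hr) (of x)).trans
    (FreeStarAlgebra.lift_of f x)

/-- Two `*`-homomorphisms which agree on the generators are equal. -/
theorem hom_ext {C : Type*} [CStarAlgebra C] {f g : UniversalCStar b r →⋆ₐ[ℂ] C}
    (h : ∀ x, f (gen b r x) = g (gen b r x)) : f = g := by
  have key : ∀ a, f (mkHom b r a) = g (mkHom b r a) := by
    intro a
    induction a using FreeStarAlgebra.induction with
    | scalar c => simp only [AlgHomClass.commutes]
    | letter y =>
      obtain ⟨x, s⟩ := y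
      cases s with
      | false => exact h x
      | true =>
        have : letter (x, true) = star (of x) := by rw [of, star_letter]; rfl
        rw [this, map_star, map_star, map_star]
        exact congrArg star (h x)
    | mul a c ha hc => simp only [map_mul, ha, hc]
    | add a c ha hc => simp only [map_add, ha, hc]
  have hc : ∀ k : UniversalCStar b r →⋆ₐ[ℂ] C, Continuous k := fun k =>
    AddMonoidHomClass.continuous_of_bound k 1 fun a => by
      rw [one_mul]; exact NonUnitalStarAlgHom.norm_apply_le k a
  ext a
  induction a using induction_on with
  | closed => exact isClosed_eq (hc f) (hc g)
  | mk a => exact key a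

end UniversalCStar

end Universal

/-! ## Group C*-algebras and crossed products -/

section CrossedProduct

open FreeStarAlgebra

/-- The relations of a unitary representation of the group `Γ`. -/
inductive GroupRel (Γ : Type*) [Group Γ] : FreeStarAlgebra Γ → FreeStarAlgebra Γ → Prop
  | one : GroupRel Γ (of 1) 1
  | mul (g h : Γ) : GroupRel Γ (of (g * h)) (of g * of h)
  | star (g : Γ) : GroupRel Γ (of g⁻¹) (star (of g))

/-- The (full) group C*-algebra `C*(Γ)` of a discrete group: the universal C*-algebra
generated by a unitary representation of `Γ`. -/
abbrev GroupCStar (Γ : Type*) [Group Γ] : Type _ := UniversalCStar (fun _ : Γ => 1) (GroupRel Γ)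

namespace GroupCStar

variable {Γ : Type*} [Group Γ]

/-- The canonical unitary `δ g` in `C*(Γ)`. -/
def delta (g : Γ) : GroupCStar Γ := UniversalCStar.gen _ _ g

theorem delta_one : delta (1 : Γ) = 1 :=
  (UniversalCStar.mkHom_eq_of_rel _ _ (GroupRel.one (Γ := Γ))).trans (map_one _)

theorem delta_mul (g h : Γ) : delta (g * h) = delta g * delta h :=
  (UniversalCStar.mkHom_eq_of_rel _ _ (GroupRel.mul g h)).trans (map_mul _ _ _)

theorem delta_inv (g : Γ) : delta g⁻¹ = star (delta g) :=
  (UniversalCStar.mkHom_eq_of_rel _ _ (GroupRel.star g)).trans (map_star _ _)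

theorem norm_delta_le (g : Γ) : ‖delta g‖ ≤ 1 :=
  (UniversalCStar.norm_mk _ _ _).le.trans
    (maxNorm_le _ _ zero_le_one fun p => by simpa using p.2.1 g)

/-- The endomorphism (in fact automorphism) `δ g ↦ χ(g) δ g` of `C*(Γ)` given by a character
`χ` of `Γ`. -/
def twist (χ : Γ →* Circle) : GroupCStar Γ →⋆ₐ[ℂ] GroupCStar Γ :=
  UniversalCStar.lift (fun g => (χ g : ℂ) • delta g)
    (fun g => by
      rw [norm_smul, Circle.norm_coe, one_mul]
      exact norm_delta_le g)
    (fun x y h => by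
      cases h with
      | one => simp [FreeStarAlgebra.lift_of, delta_one]
      | mul g h => simp [FreeStarAlgebra.lift_of, delta_mul, smul_smul, mul_comm]
      | star g =>
        simp only [FreeStarAlgebra.lift_of, delta_inv, map_star, map_inv,
          Circle.coe_inv_eq_conj, star_smul]
        rfl)

theorem twist_delta (χ : Γ →* Circle) (g : Γ) : twist χ (delta g) = (χ g : ℂ) • delta g :=
  UniversalCStar.lift_gen _ _ _ g

/-- The dual action of the characters of `Γ` on `C*(Γ)`. -/
def dualAction : (Γ →* Circle) →* (GroupCStar Γ →⋆ₐ[ℂ] GroupCStar Γ) where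
  toFun := twist
  map_one' := UniversalCStar.hom_ext fun g =>
    (twist_delta 1 g).trans (by simp only [MonoidHom.one_apply, Circle.coe_one, one_smul]; rfl)
  map_mul' χ χ' := UniversalCStar.hom_ext fun g => by
    change twist _ (delta g) = twist χ (twist χ' (delta g))
    simp only [twist_delta, map_smul, smul_smul]
    simp [mul_comm]

end GroupCStar

variable {A : Type*} [CStarAlgebra A] {Γ : Type*} [Group Γ] (β : Γ →* (A →⋆ₐ[ℂ] A))

/-- The relations of a covariant representation of `(A, Γ, β)`: a unital `*`-homomorphism on `A`
and a unitary representation of `Γ` with `u_g a = β_g(a) u_g`. -/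
inductive CrossedRel : FreeStarAlgebra (A ⊕ Γ) → FreeStarAlgebra (A ⊕ Γ) → Prop
  | alg_one : CrossedRel (of (Sum.inl 1)) 1
  | alg_smul (c : ℂ) (a : A) : CrossedRel (of (Sum.inl (c • a))) (c • of (Sum.inl a))
  | alg_add (a a' : A) :
      CrossedRel (of (Sum.inl (a + a'))) (of (Sum.inl a) + of (Sum.inl a'))
  | alg_mul (a a' : A) :
      CrossedRel (of (Sum.inl (a * a'))) (of (Sum.inl a) * of (Sum.inl a'))
  | alg_star (a : A) : CrossedRel (of (Sum.inl (star a))) (star (of (Sum.inl a)))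
  | grp_one : CrossedRel (of (Sum.inr 1)) 1
  | grp_mul (g h : Γ) :
      CrossedRel (of (Sum.inr (g * h))) (of (Sum.inr g) * of (Sum.inr h))
  | grp_star (g : Γ) : CrossedRel (of (Sum.inr g⁻¹)) (star (of (Sum.inr g)))
  | covariant (g : Γ) (a : A) :
      CrossedRel (of (Sum.inr g) * of (Sum.inl a)) (of (Sum.inl (β g a)) * of (Sum.inr g))

/-- The (full) crossed product `A ⋊_β Γ` of a unital C*-algebra by an action (necessarily by
automorphisms) of a discrete group: the universal C*-algebra for covariant representations.
The bound `‖a‖` on the generators `a : A` holds automatically for `*`-homomorphisms on `A`. -/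
abbrev CrossedProduct : Type _ :=
  UniversalCStar (Sum.elim (fun a : A => ‖a‖₊) (fun _ : Γ => 1)) (CrossedRel β)

namespace CrossedProduct

/-- The canonical copy of `a : A` in `A ⋊ Γ`. -/
def coeff (a : A) : CrossedProduct β := UniversalCStar.gen _ _ (Sum.inl a)

/-- The canonical unitary of `g : Γ` in `A ⋊ Γ`. -/
def grp (g : Γ) : CrossedProduct β := UniversalCStar.gen _ _ (Sum.inr g)

end CrossedProduct

/-- The translation action `(x · f)(y) = f(x⁻¹ y)` of a topological group `Y` on `C(Y)`. -/
def translation (Y : Type*) [TopologicalSpace Y] [Group Y] [IsTopologicalGroup Y] :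
    Y →* (C(Y, ℂ) →⋆ₐ[ℂ] C(Y, ℂ)) where
  toFun x := ContinuousMap.compStarAlgHom' ℂ ℂ ⟨fun y => x⁻¹ * y, by fun_prop⟩
  map_one' := by
    ext f y
    exact congrArg f (by simp : (1 : Y)⁻¹ * y = y)
  map_mul' x y := by
    ext f z
    exact congrArg f (by simp [mul_assoc] : (x * y)⁻¹ * z = y⁻¹ * (x⁻¹ * z))

end CrossedProduct

/-! ## Simplicity and traces -/

/-- A C*-algebra is simple if it is nonzero and has no closed two-sided ideals except `0` and
itself. -/
def IsSimpleCStar (B : Type*) [Ring B] [TopologicalSpace B] : Prop :=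
  Nontrivial B ∧ ∀ I : TwoSidedIdeal B, IsClosed (I : Set B) → I = ⊥ ∨ I = ⊤

open scoped ComplexOrder in
/-- A (normalized) trace: a positive linear functional with `τ(1) = 1` and `τ(xy) = τ(yx)`. -/
structure IsTrace {B : Type*} [Ring B] [StarRing B] [Algebra ℂ B] (τ : B →ₗ[ℂ] ℂ) : Prop where
  map_one : τ 1 = 1
  nonneg : ∀ x, 0 ≤ τ (star x * x)
  comm : ∀ x y, τ (x * y) = τ (y * x)

/-! ## The groups attached to an endomorphism -/

section Groups

variable {G : Type*} [CommGroup G] (φ : G →* G)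

/-- The subgroup `φⁿ(G)`. -/
def powRange (n : ℕ) : Subgroup G where
  carrier := Set.range (φ^[n])
  one_mem' := ⟨1, iterate_map_one φ n⟩
  mul_mem' := by
    rintro _ _ ⟨x, rfl⟩ ⟨y, rfl⟩
    exact ⟨x * y, iterate_map_mul φ n x y⟩
  inv_mem' := by
    rintro _ ⟨x, rfl⟩
    exact ⟨x⁻¹, iterate_map_inv φ n x⟩

theorem powRange_succ (n : ℕ) : powRange φ (n + 1) = (powRange φ n).map φ := by
  ext x
  constructor
  · rintro ⟨y, rfl⟩
    exact ⟨φ^[n] y, ⟨y, rfl⟩, (Function.iterate_succ_apply' φ n y).symm⟩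
  · rintro ⟨_, ⟨y, rfl⟩, rfl⟩
    exact ⟨y, Function.iterate_succ_apply' φ n y⟩

theorem powRange_succ_le (n : ℕ) : powRange φ (n + 1) ≤ powRange φ n := by
  rintro _ ⟨y, rfl⟩
  exact ⟨φ y, rfl⟩

instance [hfin : Finite (G ⧸ φ.range)] (n : ℕ) : Finite (G ⧸ powRange φ n) := by
  have h1 : φ.range.FiniteIndex := Subgroup.finiteIndex_of_finite_quotient
  suffices h : (powRange φ n).FiniteIndex by exact Subgroup.finite_quotient_of_finiteIndex
  induction n with
  | zero =>
    have : powRange φ 0 = ⊤ := by ext x; exact ⟨fun _ => trivial, fun _ => ⟨x, rfl⟩⟩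
    rw [this]; infer_instance
  | succ n ih =>
    refine ⟨?_⟩
    rw [powRange_succ, Subgroup.index_map]
    have h2 : (powRange φ n ⊔ φ.ker).FiniteIndex := Subgroup.finiteIndex_of_le le_sup_left
    exact mul_ne_zero h2.index_ne_zero h1.index_ne_zero

/-- The `φ`-adic completion `K = lim G/φⁿ(G)` of `G`, as the group of compatible sequences in
`∏ G/φⁿ(G)`. -/
def adicCompletion : Subgroup (∀ n, G ⧸ powRange φ n) where
  carrier := {k | ∀ n, QuotientGroup.map _ _ (MonoidHom.id G) (powRange_succ_le φ n) (k (n + 1))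
    = k n}
  one_mem' n := map_one _
  mul_mem' {k l} hk hl n := by
    rw [Pi.mul_apply, map_mul, hk n, hl n]; rfl
  inv_mem' {k} hk n := by
    rw [Pi.inv_apply, map_inv, hk n]; rfl

/-- The canonical homomorphism `G → K`. -/
def toCompletion : G →* adicCompletion φ where
  toFun g := ⟨fun n => (g : G ⧸ powRange φ n), fun _ => rfl⟩
  map_one' := rfl
  map_mul' _ _ := rfl

variable [TopologicalSpace G] [DiscreteTopology G]

instance (n : ℕ) : DiscreteTopology (G ⧸ powRange φ n) :=
  QuotientGroup.discreteTopology (isOpen_discrete _)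

/-- `K` carries the topology induced from the product of the discrete spaces `G/φⁿ(G)`. It is
compact if `G/φ(G)` is finite. -/
instance [Finite (G ⧸ φ.range)] : CompactSpace (adicCompletion φ) := by
  refine isCompact_iff_compactSpace.mp (IsClosed.isCompact ?_)
  have : (adicCompletion φ : Set (∀ n, G ⧸ powRange φ n)) = ⋂ n, {k |
      QuotientGroup.map _ _ (MonoidHom.id G) (powRange_succ_le φ n) (k (n + 1)) = k n} := by
    ext k; simp [adicCompletion]
  rw [this]
  exact isClosed_iInter fun n => isClosed_eq
    (continuous_of_discreteTopology.comp (continuous_apply (n + 1))) (continuous_apply n)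

/-- The characteristic function on `K` of the set of `k` with `n`-th coordinate `g φⁿ(G)`. -/
def cosetIndicator (n : ℕ) (g : G) : C(adicCompletion φ, ℂ) where
  toFun k := Set.indicator {(g : G ⧸ powRange φ n)} (fun _ => (1 : ℂ)) (k.1 n)
  continuous_toFun := (continuous_of_discreteTopology (α := G ⧸ powRange φ n)
    (f := Set.indicator {(g : G ⧸ powRange φ n)} fun _ => (1 : ℂ))).comp
    ((continuous_apply n).comp continuous_subtype_val)

/-- The dual endomorphism `α : χ ↦ χ ∘ φ` of the dual group `H` of `G`. -/
def dualEndo : PontryaginDual G →* PontryaginDual G :=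
  (PontryaginDual.map (⟨φ, continuous_of_discreteTopology⟩ : G →ₜ* G)).toMonoidHom

/-- The group `L = lim Ker (αⁿ)`, i.e. the increasing union of the kernels of `αⁿ` in `H`. -/
def kerUnion : Subgroup (PontryaginDual G) where
  carrier := {χ | ∃ n, (dualEndo φ)^[n] χ = 1}
  one_mem' := ⟨0, rfl⟩
  mul_mem' := by
    rintro χ ψ ⟨n, hn⟩ ⟨m, hm⟩
    refine ⟨n + m, ?_⟩
    rw [iterate_map_mul, Function.iterate_add_apply _ n m ψ, hm, iterate_map_one, add_comm n m,
      Function.iterate_add_apply, hn, iterate_map_one, one_mul]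
  inv_mem' := by
    rintro χ ⟨n, hn⟩
    exact ⟨n, by rw [iterate_map_inv, hn, inv_one]⟩

/-- The pairing `G × L → 𝕋`, `(g, l) ↦ ⟨g | l⟩ = l(g)`. -/
def pairing : G →* kerUnion φ →* Circle where
  toFun g := { toFun := fun l => l.1 g, map_one' := rfl, map_mul' := fun _ _ => rfl }
  map_one' := by ext l; exact congrArg _ (map_one l.1)
  map_mul' g h := by ext l; exact congrArg _ (map_mul l.1 g h)

/-- The action `g · w_l = ⟨g | l⟩ w_l` of `G` on `C*(L)`. -/
def actionOnCStarL : G →* (GroupCStar (kerUnion φ) →⋆ₐ[ℂ] GroupCStar (kerUnion φ)) :=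
  GroupCStar.dualAction.comp (pairing φ)

/-- The action `l · u_g = ⟨g | l⟩⁻¹ u_g` of `L` on `C*(G)`. -/
def actionOnCStarG : kerUnion φ →* (GroupCStar G →⋆ₐ[ℂ] GroupCStar G) :=
  GroupCStar.dualAction.comp (pairing φ).flip⁻¹

/-- The character of `H` given by evaluation at `g`. -/
def evalChar (g : G) : C(PontryaginDual G, ℂ) where
  toFun χ := (χ g : ℂ)
  continuous_toFun := by
    have h : Continuous fun χ : PontryaginDual G => χ g :=
      (ContinuousEvalConst.continuous_eval_const (F := C(G, Circle)) g).comp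
        (ContinuousMonoidHom.isInducing_toContinuousMap G Circle).continuous
    exact continuous_subtype_val.comp h

end Groups

/-! ## The algebra `A_φ` and its subalgebra `B_φ` -/

section Algebra

open FreeStarAlgebra

/-- The generators of `A_φ`. -/
inductive EndoGen (G : Type*)
  | s : EndoGen G
  | u (g : G) : EndoGen G

variable {G : Type*} [CommGroup G] (φ : G →* G)

/-- The relations of `A_φ`: `s` is an isometry, the `u g` are unitaries, `u_g u_h = u_{gh}`,
`s u_g = u_{φ(g)} s` and `∑_{x ∈ G/φ(G)} u_x s s* u_x* = 1`. By the other relations the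
summands do not depend on the choice of the coset representatives. -/
inductive EndoRel : FreeStarAlgebra (EndoGen G) → FreeStarAlgebra (EndoGen G) → Prop
  | isometry : EndoRel (star (of EndoGen.s) * of EndoGen.s) 1
  | unitary_left (g : G) : EndoRel (star (of (EndoGen.u g)) * of (EndoGen.u g)) 1
  | unitary_right (g : G) : EndoRel (of (EndoGen.u g) * star (of (EndoGen.u g))) 1
  | mul (g h : G) : EndoRel (of (EndoGen.u g) * of (EndoGen.u h)) (of (EndoGen.u (g * h)))
  | shift (g : G) :
      EndoRel (of EndoGen.s * of (EndoGen.u g)) (of (EndoGen.u (φ g)) * of EndoGen.s)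
  | sum : EndoRel (∑ᶠ x : G ⧸ φ.range, of (EndoGen.u x.out) * of EndoGen.s *
      star (of EndoGen.s) * star (of (EndoGen.u x.out))) 1

/-- The universal C*-algebra `A_φ` generated by an isometry `s` and unitaries `u_g` with the
above relations. (The bound `1` on the norms of the generators follows from the relations.) -/
abbrev EndoAlgebra : Type _ := UniversalCStar (fun _ : EndoGen G => 1) (EndoRel φ)

/-- The isometry `s` in `A_φ`. -/
def sGen : EndoAlgebra φ := UniversalCStar.gen _ _ EndoGen.s

/-- The unitaries `u_g` in `A_φ`. -/
def uGen (g : G) : EndoAlgebra φ := UniversalCStar.gen _ _ (EndoGen.u g)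

/-- The projections `u_g sⁿ s*ⁿ u_g*` in `A_φ`. -/
def proj (n : ℕ) (g : G) : EndoAlgebra φ :=
  uGen φ g * sGen φ ^ n * star (sGen φ) ^ n * star (uGen φ g)

/-- The C*-subalgebra generated by a set (with the unit). -/
def cstarGen {A : Type*} [CStarAlgebra A] (S : Set A) : StarSubalgebra ℂ A :=
  (StarAlgebra.adjoin ℂ S).topologicalClosure

/-- The copy of `C(H) = C*(G)` in `A_φ`, generated by the unitaries `u_g`. -/
def subalgCH : StarSubalgebra ℂ (EndoAlgebra φ) := cstarGen (Set.range (uGen φ))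

/-- The copy `𝒟` of `C(K) = C*(L)` in `A_φ`, generated by the projections `u_g sⁿ s*ⁿ u_g*`. -/
def subalgCK : StarSubalgebra ℂ (EndoAlgebra φ) :=
  cstarGen (Set.range fun x : ℕ × G => proj φ x.1 x.2)

/-- The C*-subalgebra `B_φ` of `A_φ` generated by `C(H)` together with `C(K)`. -/
def subalgB : StarSubalgebra ℂ (EndoAlgebra φ) :=
  cstarGen ((subalgCH φ : Set (EndoAlgebra φ)) ∪ subalgCK φ)

end Algebra

end

end EndoAlg

open EndoAlg

set_option linter.unusedSectionVars false

namespace EndoAlg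

noncomputable section

open Topology

section

open MeasureTheory

/-! ## Averaging over a compact group of automorphisms -/

/-! The central object is `C*(L) ⋊ G`, formed with the bicharacter `⟨g | l⟩`. It is densely spanned
by the unitaries `w_l u_g`, indexed by `G × L`, and these commute up to the antisymmetrized
bicharacter. That bicharacter is nondegenerate: an element of `L` trivial on `G` is the trivial
character, and an element `g ≠ 1` lies outside some `φⁿ(G)`, hence is detected by a character of the
finite group `G/φⁿ(G)`.

Nondegeneracy gives simplicity and the trace (`WeylSystem.isSimple_and_existsUnique_trace`). By
universality every character of `G × L` acts on the algebra by rescaling the `w_l u_g`. Conjugation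
by one of these unitaries is such an action, and the closure of the conjugations is a compact group.
Averaging over it kills every `w_l u_g` except `1`, so its values are scalars; it is faithful on
positive elements, and it maps each closed ideal to itself because conjugations do. Hence a nonzero
closed ideal contains a nonzero scalar. The averaging scalar is a trace, and any trace must vanish
on a unitary that some conjugation multiplies by a number other than `1`.

This is transferred to `A_φ` by `homB : C*(L) ⋊ G → A_φ`. The projections `u_g sⁿ s*ⁿ u_g*` commute,
and a character of the algebra they generate selects one coset at each level, i.e. a point of `K`;
Gelfand duality then gives `homCK : C(K) → A_φ`. Under it `f_l` becomes a unitary `w_l` with `u_g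
w_l = ⟨g | l⟩ w_l u_g`. The representation on `ℓ²(G)` shows `A_φ ≠ 0` (`nontrivial_endoAlgebra`), so
`C*(L) ⋊ G` is nonzero too, and simplicity makes `homB` injective. Injectivity on `C*(L)` and
`C*(G)` follows from their twists by characters (`GroupCStar.injective_of_twist`), and `C*(L) ≅
C(K)` from Stone–Weierstrass. The remaining crossed products arise by exchanging `G` and `L` and by
transport along `C*(L) ≅ C(K)` and `C*(G) ≅ C(H)`. -/

theorem continuous_starAlgHom {A C : Type*} [CStarAlgebra A] [CStarAlgebra C]
    (f : A →⋆ₐ[ℂ] C) : Continuous f :=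
  AddMonoidHomClass.continuous_of_bound f 1 fun a => by
    rw [one_mul]; exact NonUnitalStarAlgHom.norm_apply_le f a

section Average

variable {A : Type*} [CStarAlgebra A] {P : Type*} [CommGroup P] [TopologicalSpace P]
  [IsTopologicalGroup P] [CompactSpace P] [MeasurableSpace P] [BorelSpace P]
  (μ : Measure P) [IsProbabilityMeasure μ] [μ.IsHaarMeasure]
  (θ : P →* (A →⋆ₐ[ℂ] A))

theorem integrable_orbit {x : A} (hx : Continuous fun p => θ p x) :
    Integrable (fun p => θ p x) μ :=
  hx.integrable_of_hasCompactSupport (HasCompactSupport.of_compactSpace _)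

/-- The average of `θ p x` over a compact group acting on `A`. -/
def average (hθ : ∀ x, Continuous fun p => θ p x) : A →L[ℂ] A :=
  LinearMap.mkContinuous
    { toFun := fun x => ∫ p, θ p x ∂μ
      map_add' := fun x y => by
        simp only [map_add]
        exact integral_add (integrable_orbit μ θ (hθ x)) (integrable_orbit μ θ (hθ y))
      map_smul' := fun c x => by
        simp only [map_smul, RingHom.id_apply]
        exact integral_smul c _ } 1 fun x => by
    refine (norm_integral_le_of_norm_le_const (C := ‖x‖)
      (.of_forall fun p => NonUnitalStarAlgHom.norm_apply_le (θ p) x)).trans ?_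
    simp

variable {θ} (hθ : ∀ x, Continuous fun p => θ p x)

theorem average_apply (x : A) : average μ θ hθ x = ∫ p, θ p x ∂μ := rfl

/-- Translation invariance of Haar measure, with commutativity of `P` turning right translation into
left translation. -/
theorem average_act (q : P) (x : A) : average μ θ hθ (θ q x) = average μ θ hθ x := by
  rw [average_apply, average_apply, ← integral_mul_left_eq_self (fun p => θ p x) q]
  refine integral_congr_ae (.of_forall fun p => ?_)
  change (θ p * θ q) x = _
  rw [← map_mul, mul_comm]

theorem average_mem {s : Set A} (hs : Convex ℝ s) (hc : IsClosed s) {x : A}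
    (hx : ∀ p, θ p x ∈ s) : average μ θ hθ x ∈ s :=
  hs.integral_mem hc (.of_forall hx) (integrable_orbit μ θ (hθ x))

/-- Applying `θ q` first leaves the average unchanged, but here it also multiplies it by `c q`; one
`q` with `c q ≠ 1` forces it to vanish. -/
theorem average_eigenvector {x : A} {c : P →* Circle} (hc : c ≠ 1)
    (h : ∀ p, θ p x = (c p : ℂ) • x) : average μ θ hθ x = 0 := by
  obtain ⟨q, hq⟩ : ∃ q, c q ≠ 1 := by
    by_contra! hq
    exact hc (MonoidHom.ext hq)
  have h1 := average_act μ hθ q x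
  have h3 : ((c q : ℂ) - 1) • average μ θ hθ x = 0 := by
    rw [sub_smul, one_smul, ← map_smul, ← h q, h1, sub_self]
  refine (smul_eq_zero.mp h3).resolve_left fun h2 => hq ?_
  exact Circle.ext (by simpa using sub_eq_zero.mp h2)

variable [PartialOrder A] [StarOrderedRing A]

theorem average_nonneg {x : A} (hx : 0 ≤ x) : 0 ≤ average μ θ hθ x :=
  integral_nonneg fun p => map_nonneg (θ p) hx

/-- Near the identity of `P` the orbit of `x` stays within `‖x‖ / 2` of `x`, and this neighbourhood
`U` has positive Haar measure. The integrals over `U` and its complement are positive with sum zero,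
so the mean over `U` is zero; yet that mean lies in a ball around `x` that misses `0`. -/
theorem eq_zero_of_average_eq_zero {x : A} (hx : 0 ≤ x) (h : average μ θ hθ x = 0) : x = 0 := by
  by_contra hne
  have hpos : 0 < ‖x‖ := norm_pos_iff.mpr hne
  set U : Set P := {p | θ p x ∈ Metric.ball x (‖x‖ / 2)} with hU
  have hUo : IsOpen U := Metric.isOpen_ball.preimage (hθ x)
  have h1 : (1 : P) ∈ U := by
    change θ 1 x ∈ Metric.ball _ _
    rw [map_one]
    exact Metric.mem_ball_self (half_pos hpos)
  have hμU : μ U ≠ 0 := (hUo.measure_pos μ ⟨1, h1⟩).ne'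
  have hint := integrable_orbit μ θ (hθ x)
  have hsum := integral_add_compl (f := fun p => θ p x) hUo.measurableSet hint
  have e1 : 0 ≤ ∫ p in U, θ p x ∂μ := integral_nonneg fun p => map_nonneg (θ p) hx
  have e2 : 0 ≤ ∫ p in Uᶜ, θ p x ∂μ := integral_nonneg fun p => map_nonneg (θ p) hx
  rw [average_apply] at h
  rw [h] at hsum
  have e3 : ∫ p in U, θ p x ∂μ = 0 :=
    le_antisymm (by rw [← hsum]; exact le_add_of_nonneg_right e2) e1
  have h2 := (convex_closedBall x (‖x‖ / 2)).set_average_mem Metric.isClosed_closedBall hμU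
    (measure_ne_top μ U) (f := fun p => θ p x) ((ae_restrict_iff' hUo.measurableSet).mpr
      (.of_forall fun p hp => Metric.ball_subset_closedBall hp)) hint.integrableOn
  rw [setAverage_eq, e3, smul_zero, Metric.mem_closedBall, dist_zero_left] at h2
  linarith

end Average

end

section

open MeasureTheory

/-! ## Linear spans of unitaries that commute up to a nondegenerate bicharacter -/

/-- Unitaries `v γ` in `A`, indexed by an abelian group, with dense span, which commute up to a
nondegenerate bicharacter `b` and on which the characters of the index group act. -/
structure WeylSystem (A : Type*) [CStarAlgebra A] (Γ : Type*) [CommGroup Γ] where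
  v : Γ → A
  b : Γ →* Γ →* Circle
  act : (Γ →* Circle) → (A →⋆ₐ[ℂ] A)
  v_one : v 1 = 1
  star_mul_self : ∀ γ, star (v γ) * v γ = 1
  conj : ∀ γ γ', v γ * v γ' * star (v γ) = (b γ γ' : ℂ) • v γ'
  act_v : ∀ χ γ, act χ (v γ) = (χ γ : ℂ) • v γ
  dense : Dense (Submodule.span ℂ (Set.range v) : Set A)
  nondegenerate : ∀ γ', (∀ γ, b γ γ' = 1) → γ' = 1

namespace WeylSystem

variable {A : Type*} [CStarAlgebra A] {Γ : Type*} [CommGroup Γ] (W : WeylSystem A Γ)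

theorem mul_star_self [Nontrivial A] (γ : Γ) : W.v γ * star (W.v γ) = 1 := by
  have := W.conj γ 1
  rwa [W.v_one, mul_one, map_one, Circle.coe_one, one_smul] at this

theorem induction {motive : A → Prop} (closed : IsClosed {x | motive x})
    (v : ∀ γ, motive (W.v γ)) (add : ∀ x y, motive x → motive y → motive (x + y))
    (smul : ∀ (c : ℂ) x, motive x → motive (c • x)) (x : A) : motive x := by
  have h : (Submodule.span ℂ (Set.range W.v) : Set A) ⊆ {x | motive x} := by
    intro y hy
    induction hy using Submodule.span_induction with
    | mem x hx => obtain ⟨γ, rfl⟩ := hx; exact v γ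
    | zero => simpa using smul 0 _ (v 1)
    | add x y _ _ hx hy => exact add x y hx hy
    | smul c x _ hx => exact smul c x hx
  exact (closed.closure_subset_iff.mpr h) (W.dense x)

theorem continuous_ext {E : Type*} [NormedAddCommGroup E] [NormedSpace ℂ E] {f g : A →ₗ[ℂ] E}
    (hf : Continuous f) (hg : Continuous g) (h : ∀ γ, f (W.v γ) = g (W.v γ)) : f = g := by
  ext x
  induction x using W.induction with
  | closed => exact isClosed_eq hf hg
  | v γ => exact h γ
  | add x y hx hy => simp [hx, hy]
  | smul c x hx => simp [hx]

theorem hom_ext {C : Type*} [CStarAlgebra C] {f g : A →⋆ₐ[ℂ] C}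
    (h : ∀ γ, f (W.v γ) = g (W.v γ)) : f = g := by
  have := W.continuous_ext (f := f.toAlgHom.toLinearMap) (g := g.toAlgHom.toLinearMap)
    (continuous_starAlgHom f) (continuous_starAlgHom g) h
  exact StarAlgHom.ext fun x => LinearMap.congr_fun this x

/-- The closure of the characters `b γ` in the compact group of all characters of `Γ`. -/
def dual [TopologicalSpace Γ] [DiscreteTopology Γ] : Subgroup (PontryaginDual Γ) :=
  ((W.b.range).comap ⟨⟨fun χ : PontryaginDual Γ => (χ : Γ →* Circle), rfl⟩,
    fun _ _ => rfl⟩).topologicalClosure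

variable [TopologicalSpace Γ] [DiscreteTopology Γ]

instance : CompactSpace W.dual :=
  isCompact_iff_compactSpace.mp (Subgroup.isClosed_topologicalClosure _).isCompact

/-- The character `b γ`, as an element of `W.dual`. -/
def inner (γ : Γ) : W.dual :=
  ⟨⟨W.b γ, continuous_of_discreteTopology⟩, Subgroup.le_topologicalClosure _ ⟨γ, rfl⟩⟩

/-- The reason for taking the closure of the inner characters and not all characters: a closed
condition on `p` need only be checked where the action is a conjugation. -/
theorem denseRange_inner : DenseRange W.inner := by
  intro p
  rw [closure_subtype]
  refine closure_mono ?_ p.2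
  rintro χ ⟨γ, hγ⟩
  refine ⟨W.inner γ, ⟨γ, rfl⟩, ?_⟩
  exact DFunLike.ext _ _ fun x => DFunLike.congr_fun hγ x

/-- The action of `W.dual` on `A`. -/
def action : W.dual →* (A →⋆ₐ[ℂ] A) where
  toFun p := W.act p.1
  map_one' := W.hom_ext fun γ => by
    rw [W.act_v]
    exact one_smul _ _
  map_mul' p q := W.hom_ext fun γ => by
    change _ = W.act p.1 (W.act q.1 (W.v γ))
    simp only [W.act_v, map_smul, smul_smul]
    congr 1
    exact mul_comm (p.1 γ : ℂ) (q.1 γ)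

theorem action_v (p : W.dual) (γ : Γ) : W.action p (W.v γ) = (p.1 γ : ℂ) • W.v γ := W.act_v _ _

/-- The maps `W.action p` are contractive, so convergence `u n → x` makes the orbit maps converge
uniformly in `p`, and the set of `x` with continuous orbit is closed. On `v γ` the orbit is
evaluation at `γ` times a fixed vector. -/
theorem continuous_action (x : A) : Continuous fun p => W.action p x := by
  induction x using W.induction with
  | closed =>
    rw [← isSeqClosed_iff_isClosed]
    intro u x hu hux
    rw [Set.mem_ofPred_eq]
    refine TendstoUniformly.continuous (F := fun n p => W.action p (u n)) (p := Filter.atTop) ?_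
      (Filter.Eventually.of_forall hu).frequently
    rw [Metric.tendstoUniformly_iff]
    intro ε hε
    filter_upwards [Metric.tendsto_nhds.mp hux ε hε] with n hn p
    rw [dist_eq_norm, ← map_sub]
    refine (NonUnitalStarAlgHom.norm_apply_le (W.action p) _).trans_lt ?_
    rwa [← dist_eq_norm, dist_comm]
  | v γ =>
    simp only [W.action_v]
    exact ((evalChar γ).continuous.comp continuous_subtype_val).smul continuous_const
  | add x y hx hy => simp only [map_add]; exact hx.add hy
  | smul c x hx => simp only [map_smul]; exact hx.const_smul c

/-- Both sides are continuous and linear in `x`, and on `v γ'` they agree by `conj`. This ties the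
compact group to ideals and to the trace property. -/
theorem action_inner (γ : Γ) (x : A) : W.action (W.inner γ) x = W.v γ * x * star (W.v γ) := by
  induction x using W.induction with
  | closed =>
    exact isClosed_eq (continuous_starAlgHom _)
      ((continuous_const.mul continuous_id).mul continuous_const)
  | v γ' => rw [W.action_v, W.conj]; rfl
  | add x y hx hy => simp only [map_add, mul_add, add_mul, hx, hy]
  | smul c x hx => rw [map_smul, hx, mul_smul_comm, smul_mul_assoc]

/-- Evaluation at `γ` as a character of `W.dual`. -/
def eval (γ : Γ) : W.dual →* Circle where
  toFun p := p.1 γ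
  map_one' := rfl
  map_mul' _ _ := rfl

/-- Nondegeneracy enters here: the inner characters alone already detect `γ`. -/
theorem eval_ne_one {γ : Γ} (h : γ ≠ 1) : W.eval γ ≠ 1 := fun h1 =>
  h (W.nondegenerate γ fun γ' => DFunLike.congr_fun h1 (W.inner γ'))

section Haar

variable [MeasurableSpace W.dual] [BorelSpace W.dual] (μ : Measure W.dual)
  [IsProbabilityMeasure μ] [μ.IsHaarMeasure]

/-- The average over `W.dual`. -/
abbrev avg : A →L[ℂ] A := average μ W.action W.continuous_action

theorem avg_v {γ : Γ} (h : γ ≠ 1) : W.avg μ (W.v γ) = 0 :=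
  average_eigenvector μ W.continuous_action (W.eval_ne_one h) fun p => W.action_v p γ

theorem avg_one : W.avg μ 1 = 1 := by
  simp [avg, average_apply]

/-- The scalars form a closed subspace, being finite-dimensional, and the average sends each `v γ`
to `0` or `1`. -/
theorem avg_mem_range (x : A) : W.avg μ x ∈ LinearMap.range (Algebra.linearMap ℂ A) := by
  have hcl := (LinearMap.range (Algebra.linearMap ℂ A)).closed_of_finiteDimensional
  induction x using W.induction with
  | closed => exact hcl.preimage (W.avg μ).continuous
  | v γ =>
    by_cases h : γ = 1
    · rw [h, W.v_one, avg_one]; exact ⟨1, (algebraMap ℂ A).map_one⟩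
    · rw [avg_v W μ h]; exact zero_mem _
  | add x y hx hy => rw [map_add]; exact add_mem hx hy
  | smul c x hx => rw [map_smul]; exact Submodule.smul_mem _ c hx

/-- For `x = v γ`, conjugation by `v γ` carries `y * v γ` to `v γ * y`, and the average is invariant
under it. -/
theorem avg_mul_comm [Nontrivial A] (x y : A) : W.avg μ (x * y) = W.avg μ (y * x) := by
  induction x using W.induction with
  | closed =>
    exact isClosed_eq ((W.avg μ).continuous.comp (continuous_id.mul continuous_const))
      ((W.avg μ).continuous.comp (continuous_const.mul continuous_id))
  | v γ =>
    have := average_act μ W.continuous_action (W.inner γ) (y * W.v γ)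
    rw [W.action_inner, ← mul_assoc, mul_assoc, W.mul_star_self, mul_one] at this
    exact this
  | add x x' hx hx' => simp only [add_mul, mul_add, map_add, hx, hx']
  | smul c x hx => rw [smul_mul_assoc, mul_smul_comm, map_smul, map_smul, hx]

end Haar

end WeylSystem

end

section

open MeasureTheory

/-! ### Simplicity and the unique trace of an algebra with a Weyl system -/

namespace WeylSystem

variable {A : Type*} [CStarAlgebra A] {Γ : Type*} [CommGroup Γ] (W : WeylSystem A Γ)

section Haar

variable [TopologicalSpace Γ] [DiscreteTopology Γ]
  [MeasurableSpace W.dual] [BorelSpace W.dual] (μ : Measure W.dual)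
  [IsProbabilityMeasure μ] [μ.IsHaarMeasure]

/-- An ideal is stable under conjugations; closedness and density extend this to the whole compact
group. -/
theorem action_mem (I : TwoSidedIdeal A) (hI : IsClosed (I : Set A)) {x : A} (hx : x ∈ I)
    (p : W.dual) : W.action p x ∈ (I : Set A) := by
  induction p using W.denseRange_inner.induction_on with
  | ih γ =>
    rw [W.action_inner]
    exact I.mul_mem_right _ _ (I.mul_mem_left _ _ hx)
  | hp => exact hI.preimage (W.continuous_action x)

theorem avg_mem (I : TwoSidedIdeal A) (hI : IsClosed (I : Set A)) {x : A} (hx : x ∈ I) :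
    W.avg μ x ∈ I := by
  refine average_mem μ W.continuous_action (s := (I : Set A)) ?_ hI (W.action_mem I hI hx)
  intro y hy z hz a b _ _ _
  -- Ideals absorb `t • 1`, hence are real subspaces and in particular convex.
  have key : ∀ (t : ℝ) (w : A), w ∈ I → t • w ∈ I := fun t w hw => by
    rw [← one_mul w, ← smul_mul_assoc]
    exact I.mul_mem_left _ _ hw
  exact I.add_mem (key a y hy) (key b z hz)

include W μ in
-- For `x ≠ 0` in a closed ideal, the average of `star x * x` is a scalar in that ideal, nonzero by
-- faithfulness, hence invertible.
theorem isSimple_of_haar [Nontrivial A] : IsSimpleCStar A := by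
  let : PartialOrder A := CStarAlgebra.spectralOrder A
  let : StarOrderedRing A := CStarAlgebra.spectralOrderedRing A
  refine ⟨inferInstance, fun I hI => ?_⟩
  by_contra! h
  obtain ⟨x, hx, hx0⟩ : ∃ x ∈ I, x ≠ 0 := by
    by_contra! h0
    exact h.1 (le_antisymm (fun y hy => (TwoSidedIdeal.mem_bot _).mpr (h0 y hy)) bot_le)
  obtain ⟨c, hc⟩ := W.avg_mem_range μ (star x * x)
  have hmem : W.avg μ (star x * x) ∈ I := W.avg_mem μ I hI (I.mul_mem_left _ _ hx)
  have hc0 : c ≠ 0 := by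
    rintro rfl
    rw [map_zero] at hc
    have := eq_zero_of_average_eq_zero μ W.continuous_action (star_mul_self_nonneg x) hc.symm
    exact hx0 (CStarRing.star_mul_self_eq_zero_iff x |>.mp this)
  refine h.2 (TwoSidedIdeal.one_mem_iff I |>.mp ?_)
  rw [← hc, Algebra.linearMap_apply] at hmem
  have := I.mul_mem_left (algebraMap ℂ A c⁻¹) _ hmem
  rwa [← map_mul, inv_mul_cancel₀ hc0, map_one] at this

/-- The scalar by which `x` is averaged. -/
def trace [Nontrivial A] : A →ₗ[ℂ] ℂ :=
  (LinearEquiv.ofInjective (Algebra.linearMap ℂ A)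
    (algebraMap ℂ A).injective).symm.toLinearMap ∘ₗ
    (W.avg μ).toLinearMap.codRestrict _ (W.avg_mem_range μ)

theorem algebraMap_trace [Nontrivial A] (x : A) :
    algebraMap ℂ A (W.trace μ x) = W.avg μ x :=
  congrArg Subtype.val (LinearEquiv.apply_symm_apply (LinearEquiv.ofInjective
    (Algebra.linearMap ℂ A) (algebraMap ℂ A).injective) ⟨_, W.avg_mem_range μ x⟩)

open scoped ComplexOrder in
theorem isTrace_trace [Nontrivial A] : IsTrace (W.trace μ) := by
  let : PartialOrder A := CStarAlgebra.spectralOrder A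
  let : StarOrderedRing A := CStarAlgebra.spectralOrderedRing A
  have hinj := (algebraMap ℂ A).injective
  refine ⟨hinj ?_, fun x => ?_, fun x y => hinj ?_⟩
  · rw [algebraMap_trace, avg_one, map_one]
  · have h := average_nonneg μ W.continuous_action (star_mul_self_nonneg x)
    change 0 ≤ W.avg μ _ at h
    rw [← algebraMap_trace] at h
    -- A scalar lies in the spectrum of its image in `A`, so positivity descends to `ℂ`.
    exact spectrum_nonneg_of_nonneg h (by simp)
  · rw [algebraMap_trace, algebraMap_trace, avg_mul_comm]

end Haar

open scoped ComplexOrder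

/-- Every positive element has the form `star y * y`, and a positive functional on a C*-algebra is
bounded. -/
theorem _root_.EndoAlg.IsTrace.continuous {τ : A →ₗ[ℂ] ℂ} (h : IsTrace τ) : Continuous τ := by
  let : PartialOrder A := CStarAlgebra.spectralOrder A
  let : StarOrderedRing A := CStarAlgebra.spectralOrderedRing A
  have hpos : ∀ x, 0 ≤ x → 0 ≤ τ x := fun x hx => by
    obtain ⟨y, rfl⟩ := CStarAlgebra.nonneg_iff_eq_star_mul_self.mp hx
    exact h.nonneg y
  let T : A →ₚ[ℂ] ℂ := PositiveLinearMap.mk₀ τ hpos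
  obtain ⟨C, hC⟩ := PositiveLinearMap.exists_norm_apply_le T
  exact AddMonoidHomClass.continuous_of_bound τ C hC

/-- A trace is invariant under conjugation by `v γ'`, which multiplies `v γ` by `b γ' γ`;
nondegeneracy supplies a `γ'` for which this factor is not `1`. -/
theorem isTrace_v [Nontrivial A] {τ : A →ₗ[ℂ] ℂ} (h : IsTrace τ) {γ : Γ} (hγ : γ ≠ 1) :
    τ (W.v γ) = 0 := by
  obtain ⟨γ', hγ'⟩ : ∃ γ', W.b γ' γ ≠ 1 := by
    by_contra! h1
    exact hγ (W.nondegenerate γ h1)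
  have h1 : τ (W.v γ) = (W.b γ' γ : ℂ) • τ (W.v γ) := by
    rw [← map_smul, ← W.conj, h.comm, ← mul_assoc, W.star_mul_self, one_mul]
  have h3 : ((W.b γ' γ : ℂ) - 1) * τ (W.v γ) = 0 := by
    rw [sub_mul, one_mul, ← smul_eq_mul, ← h1, sub_self]
  refine (mul_eq_zero.mp h3).resolve_left fun h2 => hγ' ?_
  exact Circle.ext (by simpa using sub_eq_zero.mp h2)

include W in
theorem trace_unique [Nontrivial A] {τ σ : A →ₗ[ℂ] ℂ} (h : IsTrace τ) (h' : IsTrace σ) :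
    τ = σ :=
  W.continuous_ext h.continuous h'.continuous fun γ => by
    by_cases hγ : γ = 1
    · rw [hγ, W.v_one, h.map_one, h'.map_one]
    · rw [W.isTrace_v h hγ, W.isTrace_v h' hγ]

include W in
theorem isSimple_and_existsUnique_trace [Nontrivial A] :
    IsSimpleCStar A ∧ ∃! τ : A →ₗ[ℂ] ℂ, IsTrace τ := by
  let : TopologicalSpace Γ := ⊥
  have : DiscreteTopology Γ := ⟨rfl⟩
  let : MeasurableSpace W.dual := borel _
  have : BorelSpace W.dual := ⟨rfl⟩
  -- Normalized on the whole compact group, so a probability measure.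
  let μ : Measure W.dual := Measure.haarMeasure ⊤
  have : IsProbabilityMeasure μ := ⟨by
    simpa using Measure.haarMeasure_self (K₀ := (⊤ : TopologicalSpace.PositiveCompacts W.dual))⟩
  exact ⟨W.isSimple_of_haar μ, W.trace μ, W.isTrace_trace μ,
    fun σ hσ => W.trace_unique hσ (W.isTrace_trace μ)⟩

end WeylSystem

end

/-! ## Universal properties -/

namespace UniversalCStar

variable {X : Type*} {b : X → NNReal} {r : FreeStarAlgebra X → FreeStarAlgebra X → Prop}

theorem eq_top_of_gen_mem (S : StarSubalgebra ℂ (UniversalCStar b r))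
    (hS : IsClosed (S : Set (UniversalCStar b r))) (h : ∀ x, gen b r x ∈ S) : S = ⊤ := by
  suffices h : ∀ a, a ∈ S from eq_top_iff.mpr fun a _ => h a
  intro a
  induction a using induction_on with
  | closed => exact hS
  | mk a =>
    change mkHom b r a ∈ S
    induction a using FreeStarAlgebra.induction with
    | scalar c => rw [AlgHomClass.commutes]; exact S.algebraMap_mem c
    | letter y =>
      obtain ⟨x, s⟩ := y
      cases s with
      | false => exact h x
      | true =>
        have : FreeStarAlgebra.letter (x, true) = star (FreeStarAlgebra.of x) := by
          rw [FreeStarAlgebra.of, FreeStarAlgebra.star_letter]; rfl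
        rw [this, map_star]
        exact star_mem (h x)
    | mul a c ha hc => rw [map_mul]; exact mul_mem ha hc
    | add a c ha hc => rw [map_add]; exact add_mem ha hc

end UniversalCStar

section Unitary

variable {C : Type*} [CStarAlgebra C]

theorem norm_unitary_le (u : unitary C) : ‖(u : C)‖ ≤ 1 := by
  have h : ‖(u : C)‖ * ‖(u : C)‖ = ‖(1 : C)‖ := by
    rw [← CStarRing.norm_star_mul_self, Unitary.coe_star_mul_self]
  nontriviality C
  rw [norm_one] at h
  nlinarith [norm_nonneg (u : C)]

/-- Conjugation by a unitary. -/
def conjBy (u : unitary C) : C →⋆ₐ[ℂ] C :=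
  StarAlgHomClass.toStarAlgHom (Unitary.conjStarAlgAut ℂ C u)

theorem conjBy_apply (u : unitary C) (x : C) : conjBy u x = u * x * star (u : C) := rfl

theorem conjBy_eq_iff (u : unitary C) (x y : C) : conjBy u x = y ↔ u * x = y * u := by
  rw [conjBy_apply]
  constructor
  · rintro rfl
    rw [mul_assoc, Unitary.coe_star_mul_self, mul_one]
  · intro h
    have h2 : (u : C) * star (u : C) = 1 := Unitary.coe_mul_star_self u
    rw [h, mul_assoc, h2, mul_one]

end Unitary

namespace GroupCStar

variable {Γ : Type*} [Group Γ] {C : Type*} [CStarAlgebra C]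

/-- The canonical unitary representation of `Γ` in `C*(Γ)`. -/
def deltaHom (Γ : Type*) [Group Γ] : Γ →* unitary (GroupCStar Γ) where
  toFun g := ⟨delta g, by
    rw [Unitary.mem_iff, ← delta_inv, ← delta_mul, ← delta_mul]
    simp [delta_one]⟩
  map_one' := Subtype.ext delta_one
  map_mul' g h := Subtype.ext (delta_mul g h)

theorem coe_deltaHom (g : Γ) : (deltaHom Γ g : GroupCStar Γ) = delta g := rfl

/-- The universal property of `C*(Γ)`. -/
def liftHom (U : Γ →* unitary C) : GroupCStar Γ →⋆ₐ[ℂ] C :=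
  UniversalCStar.lift (fun g => (U g : C)) (fun g => norm_unitary_le (U g)) (by
    intro x y h
    cases h with
    | one => simp [FreeStarAlgebra.lift_of]
    | mul g h => simp [FreeStarAlgebra.lift_of]
    | star g => simp only [FreeStarAlgebra.lift_of, map_star, map_inv]; rfl)

theorem liftHom_delta (U : Γ →* unitary C) (g : Γ) : liftHom U (delta g) = U g :=
  UniversalCStar.lift_gen _ _ _ g

theorem hom_ext {f f' : GroupCStar Γ →⋆ₐ[ℂ] C} (h : ∀ g, f (delta g) = f' (delta g)) : f = f' :=
  UniversalCStar.hom_ext h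

theorem eq_top_of_delta_mem (S : StarSubalgebra ℂ (GroupCStar Γ))
    (hS : IsClosed (S : Set (GroupCStar Γ))) (h : ∀ g : Γ, delta g ∈ S) : S = ⊤ :=
  UniversalCStar.eq_top_of_gen_mem S hS h

theorem dualAction_delta (χ : Γ →* Circle) (g : Γ) :
    dualAction χ (delta g) = (χ g : ℂ) • delta g := twist_delta χ g

/-- `C*(Γ)` is commutative if `Γ` is. -/
abbrev commCStarAlgebra (Γ : Type*) [CommGroup Γ] : CommCStarAlgebra (GroupCStar Γ) where
  mul_comm := by
    -- Conjugation by `delta g` fixes all generators and is therefore the identity. Hence the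
    -- centralizer of any `y` is a closed `*`-subalgebra containing all generators.
    have h1 : ∀ (g : Γ) (y : GroupCStar Γ), delta g * y = y * delta g := fun g y => by
      have : conjBy (deltaHom Γ g) = StarAlgHom.id ℂ _ := hom_ext fun h => by
        rw [conjBy_eq_iff, coe_deltaHom, ← delta_mul, mul_comm, delta_mul]
        rfl
      exact (conjBy_eq_iff (deltaHom Γ g) y y).mp (DFunLike.congr_fun this y)
    intro x y
    have h2 := eq_top_of_delta_mem (StarSubalgebra.centralizer ℂ {y})
      (Set.isClosed_centralizer _) (fun g => by
        rw [StarSubalgebra.mem_centralizer_iff]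
        rintro z rfl
        exact ⟨(h1 g _).symm, (h1 g _).symm⟩)
    have h3 : x ∈ StarSubalgebra.centralizer ℂ {y} := h2 ▸ StarSubalgebra.mem_top
    exact ((StarSubalgebra.mem_centralizer_iff ℂ).mp h3 y rfl).1.symm

end GroupCStar

namespace CrossedProduct

variable {A : Type*} [CStarAlgebra A] {Γ : Type*} [Group Γ] (β : Γ →* (A →⋆ₐ[ℂ] A))
  {C : Type*} [CStarAlgebra C]

open UniversalCStar in
theorem coeff_smul (c : ℂ) (a : A) : coeff β (c • a) = c • coeff β a :=
  (mkHom_eq_of_rel _ _ (CrossedRel.alg_smul (β := β) c a)).trans (map_smul (mkHom _ _) _ _)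

open UniversalCStar in
theorem coeff_one : coeff β 1 = 1 :=
  (mkHom_eq_of_rel _ _ CrossedRel.alg_one).trans (map_one _)

open UniversalCStar in
/-- The canonical homomorphism `A → A ⋊ Γ`. -/
def coeffHom : A →⋆ₐ[ℂ] CrossedProduct β where
  toFun := coeff β
  map_one' := coeff_one β
  map_mul' a a' := (mkHom_eq_of_rel _ _ (CrossedRel.alg_mul a a')).trans (map_mul _ _ _)
  map_add' a a' := (mkHom_eq_of_rel _ _ (CrossedRel.alg_add a a')).trans (map_add _ _ _)
  map_star' a := (mkHom_eq_of_rel _ _ (CrossedRel.alg_star a)).trans (map_star _ _)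
  map_zero' := by simpa using coeff_smul β 0 0
  commutes' c := by
    rw [Algebra.algebraMap_eq_smul_one, coeff_smul, coeff_one, Algebra.algebraMap_eq_smul_one]

theorem coeffHom_apply (a : A) : coeffHom β a = coeff β a := rfl

open UniversalCStar in
/-- The canonical unitary representation of `Γ` in `A ⋊ Γ`. -/
def grpHom : Γ →* unitary (CrossedProduct β) :=
  have hone : grp β 1 = 1 := (mkHom_eq_of_rel _ _ CrossedRel.grp_one).trans (map_one _)
  have hmul : ∀ g h, grp β (g * h) = grp β g * grp β h := fun g h =>
    (mkHom_eq_of_rel _ _ (CrossedRel.grp_mul g h)).trans (map_mul _ _ _)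
  have hinv : ∀ g, grp β g⁻¹ = star (grp β g) := fun g =>
    (mkHom_eq_of_rel _ _ (CrossedRel.grp_star g)).trans (map_star _ _)
  { toFun := fun g => ⟨grp β g, by
      rw [Unitary.mem_iff, ← hinv, ← hmul, ← hmul]
      simp [hone]⟩
    map_one' := Subtype.ext hone
    map_mul' := fun g h => Subtype.ext (hmul g h) }

theorem grp_mul_coeff (g : Γ) (a : A) : grp β g * coeff β a = coeff β (β g a) * grp β g :=
  ((map_mul _ _ _).symm.trans
    (UniversalCStar.mkHom_eq_of_rel _ _ (CrossedRel.covariant g a))).trans (map_mul _ _ _)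

variable {β}

/-- The universal property of the crossed product. -/
def liftHom (π : A →⋆ₐ[ℂ] C) (U : Γ →* unitary C)
    (h : ∀ g a, U g * π a = π (β g a) * U g) : CrossedProduct β →⋆ₐ[ℂ] C :=
  UniversalCStar.lift (Sum.elim π fun g => (U g : C))
    (by
      rintro (a | g)
      · exact NonUnitalStarAlgHom.norm_apply_le π a
      · exact norm_unitary_le (U g))
    (by
      intro x y hr
      cases hr with
      | covariant g a => simpa [FreeStarAlgebra.lift_of] using h g a
      | grp_star g => simp only [FreeStarAlgebra.lift_of, map_star, map_inv, Sum.elim_inr]; rfl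
      | _ => simp [FreeStarAlgebra.lift_of, map_star])

section

variable (π : A →⋆ₐ[ℂ] C) (U : Γ →* unitary C) (h : ∀ g a, U g * π a = π (β g a) * U g)

theorem liftHom_coeff (a : A) : liftHom π U h (coeff β a) = π a :=
  UniversalCStar.lift_gen _ _ _ (Sum.inl a)

theorem liftHom_grp (g : Γ) : liftHom π U h (grp β g) = U g :=
  UniversalCStar.lift_gen _ _ _ (Sum.inr g)

end

theorem hom_ext {f f' : CrossedProduct β →⋆ₐ[ℂ] C}
    (h1 : f.comp (coeffHom β) = f'.comp (coeffHom β)) (h2 : ∀ g, f (grp β g) = f' (grp β g)) :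
    f = f' :=
  UniversalCStar.hom_ext (by
    rintro (a | g)
    · exact DFunLike.congr_fun h1 a
    · exact h2 g)

theorem eq_top_of_mem (S : StarSubalgebra ℂ (CrossedProduct β))
    (hS : IsClosed (S : Set (CrossedProduct β))) (h1 : ∀ a, coeff β a ∈ S)
    (h2 : ∀ g, grp β g ∈ S) : S = ⊤ :=
  UniversalCStar.eq_top_of_gen_mem S hS (by
    rintro (a | g)
    · exact h1 a
    · exact h2 g)

/-- An equivariant isomorphism of the coefficient algebras induces an isomorphism of the crossed
products. -/
theorem exists_equiv {A' : Type*} [CStarAlgebra A'] {β' : Γ →* (A' →⋆ₐ[ℂ] A')} (e : A ≃⋆ₐ[ℂ] A')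
    (he : ∀ g a, e (β g a) = β' g (e a)) :
    ∃ E : CrossedProduct β ≃⋆ₐ[ℂ] CrossedProduct β',
      (∀ a, E (coeff β a) = coeff β' (e a)) ∧ ∀ g, E (grp β g) = grp β' g := by
  let f : CrossedProduct β →⋆ₐ[ℂ] CrossedProduct β' :=
    liftHom ((coeffHom β').comp (e : A →⋆ₐ[ℂ] A')) (grpHom β') fun g a => by
      change grp β' g * coeff β' (e a) = coeff β' (e (β g a)) * grp β' g
      rw [grp_mul_coeff, he]
  let f' : CrossedProduct β' →⋆ₐ[ℂ] CrossedProduct β :=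
    liftHom ((coeffHom β).comp (e.symm : A' →⋆ₐ[ℂ] A)) (grpHom β) fun g a => by
      change grp β g * coeff β (e.symm a) = coeff β (e.symm (β' g a)) * grp β g
      rw [grp_mul_coeff]
      have h : e.symm (β' g a) = β g (e.symm a) :=
        e.injective (show e _ = e _ by rw [he, e.apply_symm_apply, e.apply_symm_apply])
      rw [h]
  have h1 : ∀ a, f (coeff β a) = coeff β' (e a) := liftHom_coeff _ _ _
  have h2 : ∀ g, f (grp β g) = grp β' g := liftHom_grp _ _ _
  have h1' : ∀ a, f' (coeff β' a) = coeff β (e.symm a) := liftHom_coeff _ _ _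
  have h2' : ∀ g, f' (grp β' g) = grp β g := liftHom_grp _ _ _
  refine ⟨StarAlgEquiv.ofStarAlgHom f f' (hom_ext (StarAlgHom.ext fun a => ?_) fun g => ?_)
    (hom_ext (StarAlgHom.ext fun a => ?_) fun g => ?_), h1, h2⟩
  · change f' (f (coeff β a)) = coeff β a
    rw [h1, h1', e.symm_apply_apply]
  · change f' (f (grp β g)) = grp β g
    rw [h2, h2']
  · change f (f' (coeff β' a)) = coeff β' a
    rw [h1', h1, e.apply_symm_apply]
  · change f (f' (grp β' g)) = grp β' g
    rw [h2', h2]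

end CrossedProduct

/-! ## Faithfulness on abelian group C*-algebras -/

/-- The character of `Γ` given by a one-dimensional representation of `C*(Γ)`. -/
def GroupCStar.charOf {Γ : Type*} [Group Γ] (f : GroupCStar Γ →⋆ₐ[ℂ] ℂ) : Γ →* Circle where
  toFun γ := ⟨f (delta γ), by
    have h : star (f (delta γ)) * f (delta γ) = 1 := by
      rw [← map_star, ← map_mul, ← delta_inv, ← delta_mul, inv_mul_cancel, delta_one, map_one]
    have h2 : ‖f (delta γ)‖ * ‖f (delta γ)‖ = 1 := by
      rw [← CStarRing.norm_star_mul_self, h, norm_one]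
    refine mem_sphere_zero_iff_norm.mpr ?_
    nlinarith [norm_nonneg (f (delta γ))]⟩
  map_one' := Circle.ext (by
    change f (delta 1) = 1
    rw [delta_one, map_one])
  map_mul' g h := Circle.ext (by
    change f (delta (g * h)) = f (delta g) * f (delta h)
    rw [delta_mul, map_mul])

theorem GroupCStar.coe_charOf {Γ : Type*} [Group Γ] (f : GroupCStar Γ →⋆ₐ[ℂ] ℂ) (γ : Γ) :
    (charOf f γ : ℂ) = f (delta γ) := rfl

/-- `C*(Γ)` is commutative here, so its Gelfand transform is injective. -/
theorem GroupCStar.eq_zero_of_forall_char {Γ : Type*} [CommGroup Γ] {x : GroupCStar Γ}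
    (h : ∀ f : GroupCStar Γ →⋆ₐ[ℂ] ℂ, f x = 0) : x = 0 := by
  let _ := commCStarAlgebra Γ
  have : WeakDual.gelfandTransform ℂ (GroupCStar Γ) x = 0 := ContinuousMap.ext fun σ =>
    h (StarAlgHomClass.toStarAlgHom σ)
  exact (gelfandTransform_bijective (GroupCStar Γ)).1 (this.trans (map_zero _).symm)

/-- The kernel is a proper ideal, hence is annihilated by some character `τ`. The maps `θ` make it
stable under all twists, and twists act transitively on the characters of `C*(Γ)`; so every
character annihilates the kernel. -/
theorem GroupCStar.injective_of_twist {Γ : Type*} [CommGroup Γ] {C : Type*} [CStarAlgebra C]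
    [Nontrivial C] (ψ : GroupCStar Γ →⋆ₐ[ℂ] C)
    (h : ∀ χ : Γ →* Circle, ∃ θ : C →⋆ₐ[ℂ] C, ∀ γ, θ (ψ (delta γ)) = (χ γ : ℂ) • ψ (delta γ)) :
    Function.Injective ψ := by
  have hker : ∀ (χ : Γ →* Circle) x, ψ x = 0 → ψ (twist χ x) = 0 := by
    intro χ x hx
    obtain ⟨θ, hθ⟩ := h χ
    have : ψ.comp (twist χ) = θ.comp ψ := GroupCStar.hom_ext fun γ => by
      change ψ (twist χ (delta γ)) = θ (ψ (delta γ))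
      rw [hθ, twist_delta, map_smul]
    have h2 : ψ (twist χ x) = θ (ψ x) := DFunLike.congr_fun this x
    rw [h2, hx, map_zero]
  let _ := commCStarAlgebra Γ
  let I : Ideal (GroupCStar Γ) := RingHom.ker ψ
  have hI : I ≠ ⊤ := RingHom.ker_ne_top _
  obtain ⟨M, hM, hIM⟩ := Ideal.exists_le_maximal I hI
  let τ := Ideal.toCharacterSpace M
  have hτ : ∀ x, ψ x = 0 → τ x = 0 := fun x hx =>
    Ideal.toCharacterSpace_apply_eq_zero_of_mem M (hIM hx)
  rw [injective_iff_map_eq_zero]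
  intro x hx
  refine eq_zero_of_forall_char fun σ => ?_
  let t : GroupCStar Γ →⋆ₐ[ℂ] ℂ := StarAlgHomClass.toStarAlgHom τ
  -- The quotient of the two characters: composing `τ` with this twist gives `σ`.
  let χ : Γ →* Circle := charOf σ * (charOf t)⁻¹
  have h1 : σ = t.comp (twist χ) := GroupCStar.hom_ext fun γ => by
    change σ (delta γ) = t (twist χ (delta γ))
    rw [twist_delta, map_smul, ← coe_charOf, ← coe_charOf, smul_eq_mul, ← Circle.coe_mul]
    simp [χ]
  have h2 : σ x = t (twist χ x) := DFunLike.congr_fun h1 x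
  rw [h2]
  exact hτ _ (hker χ x hx)

/-- The product of a unitary representation with a character. -/
def scaleHom {Γ : Type*} [Group Γ] {C : Type*} [CStarAlgebra C] (χ : Γ →* Circle)
    (U : Γ →* unitary C) : Γ →* unitary C where
  toFun g := ⟨(χ g : ℂ) • (U g : C), by
    have h := Unitary.mem_iff.mp (U g).2
    have h2 : star (χ g : ℂ) * (χ g : ℂ) = 1 := by
      rw [Complex.star_def, ← Circle.coe_inv_eq_conj, ← Circle.coe_mul, inv_mul_cancel,
        Circle.coe_one]
    rw [Unitary.mem_iff]
    simp only [star_smul, smul_mul_smul_comm, h.1, h.2, h2, mul_comm (χ g : ℂ), one_smul,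
      and_self]⟩
  map_one' := Subtype.ext (by simp)
  map_mul' g h := Subtype.ext (by
    simp [smul_smul, mul_comm])

theorem coe_scaleHom {Γ : Type*} [Group Γ] {C : Type*} [CStarAlgebra C] (χ : Γ →* Circle)
    (U : Γ →* unitary C) (g : Γ) : (scaleHom χ U g : C) = (χ g : ℂ) • (U g : C) := rfl

/-! ## Crossed products by dual actions -/

/-- The crossed product of `C*(L)` by the action of `G` given by a bicharacter. -/
abbrev DualCrossedProduct {G L : Type*} [Group G] [Group L] (b : G →* L →* Circle) : Type _ :=
  CrossedProduct (GroupCStar.dualAction.comp b)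

namespace DualCrossedProduct

open CrossedProduct GroupCStar

section General

variable {G L : Type*} [Group G] [Group L] {b : G →* L →* Circle}
  {C : Type*} [CStarAlgebra C]

/-- The canonical unitary of `l : L`. -/
def wHom (b : G →* L →* Circle) : L →* unitary (DualCrossedProduct b) where
  toFun l := ⟨coeff _ (delta l), by
    have h := Unitary.mem_iff.mp (deltaHom L l).2
    rw [Unitary.mem_iff, ← coeffHom_apply, ← map_star, ← map_mul, ← map_mul, ← coe_deltaHom,
      h.1, h.2, map_one]
    exact ⟨rfl, rfl⟩⟩
  map_one' := Subtype.ext (by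
    change coeffHom _ (delta 1) = 1
    rw [delta_one, map_one])
  map_mul' l m := Subtype.ext (by
    change coeffHom _ (delta (l * m)) = coeffHom _ (delta l) * coeffHom _ (delta m)
    rw [delta_mul, map_mul])

/-- The canonical unitary of `g : G`. -/
abbrev uHom (b : G →* L →* Circle) : G →* unitary (DualCrossedProduct b) := grpHom _

theorem u_mul_w (g : G) (l : L) : (uHom b g * wHom b l : DualCrossedProduct b) =
    (b g l : ℂ) • (wHom b l * uHom b g : DualCrossedProduct b) := by
  change grp _ g * coeff _ (delta l) = (b g l : ℂ) • (coeff _ (delta l) * grp _ g)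
  rw [grp_mul_coeff, MonoidHom.comp_apply, dualAction_delta, coeff_smul, smul_mul_assoc]

/-- Covariance is an equality of the homomorphisms `conjBy (U g) ∘ π` and `π ∘ dualAction (b g)`, so
the generators suffice. -/
theorem covariant_of_delta (π : GroupCStar L →⋆ₐ[ℂ] C) (U : G →* unitary C)
    (h : ∀ g l, (U g * π (delta l) : C) = (b g l : ℂ) • (π (delta l) * U g)) (g : G)
    (a : GroupCStar L) : U g * π a = π (GroupCStar.dualAction.comp b g a) * U g := by
  rw [← conjBy_eq_iff]
  have : (conjBy (U g)).comp π = π.comp (GroupCStar.dualAction (b g)) :=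
    GroupCStar.hom_ext fun l => by
      change conjBy (U g) (π (delta l)) = π (GroupCStar.dualAction (b g) (delta l))
      rw [conjBy_eq_iff, h, dualAction_delta, map_smul, smul_mul_assoc]
  exact DFunLike.congr_fun this a

/-- The universal property: unitary representations of `G` and `L` which commute up to `b`. -/
def lift (U : G →* unitary C) (W : L →* unitary C)
    (h : ∀ g l, (U g * W l : C) = (b g l : ℂ) • (W l * U g : C)) : DualCrossedProduct b →⋆ₐ[ℂ] C :=
  CrossedProduct.liftHom (GroupCStar.liftHom W) U
    (covariant_of_delta _ U fun g l => by rw [GroupCStar.liftHom_delta, h])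

section

variable (U : G →* unitary C) (W : L →* unitary C)
    (h : ∀ g l, (U g * W l : C) = (b g l : ℂ) • (W l * U g : C))

theorem lift_u (g : G) : lift U W h (uHom b g) = U g := liftHom_grp _ _ _ g

theorem lift_w (l : L) : lift U W h (wHom b l) = W l :=
  (liftHom_coeff _ _ _ _).trans (liftHom_delta _ _)

end

theorem hom_ext {f f' : DualCrossedProduct b →⋆ₐ[ℂ] C}
    (hu : ∀ g, f (uHom b g) = f' (uHom b g)) (hw : ∀ l, f (wHom b l) = f' (wHom b l)) :
    f = f' :=
  CrossedProduct.hom_ext (GroupCStar.hom_ext hw) hu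

theorem eq_top_of_mem (S : StarSubalgebra ℂ (DualCrossedProduct b))
    (hS : IsClosed (S : Set (DualCrossedProduct b))) (hu : ∀ g, (uHom b g : DualCrossedProduct b) ∈ S)
    (hw : ∀ l, (wHom b l : DualCrossedProduct b) ∈ S) : S = ⊤ := by
  refine CrossedProduct.eq_top_of_mem S hS (fun a => ?_) hu
  have : S.comap (coeffHom _) = ⊤ := GroupCStar.eq_top_of_delta_mem _
    (hS.preimage (continuous_starAlgHom (coeffHom _))) hw
  have h2 : a ∈ S.comap (coeffHom _) := this ▸ StarSubalgebra.mem_top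
  exact h2

end General

section Comm

variable {G L : Type*} [CommGroup G] [CommGroup L] (b : G →* L →* Circle)

/-- The unitaries `w_l u_g`. -/
def weyl (p : G × L) : DualCrossedProduct b := wHom b p.2 * uHom b p.1

theorem weyl_mem_unitary (p : G × L) : weyl b p ∈ unitary (DualCrossedProduct b) :=
  mul_mem (wHom b p.2).2 (uHom b p.1).2

theorem weyl_mul (p q : G × L) : weyl b p * weyl b q = (b p.1 q.2 : ℂ) • weyl b (p * q) := by
  have h := u_mul_w (b := b) p.1 q.2
  simp only [weyl, Prod.fst_mul, Prod.snd_mul, map_mul, Submonoid.coe_mul]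
  rw [mul_assoc, ← mul_assoc (uHom b p.1 : DualCrossedProduct b), h, smul_mul_assoc,
    mul_smul_comm]
  simp only [mul_assoc]

/-- The antisymmetrization of `b`. -/
def symplectic : G × L →* G × L →* Circle where
  toFun p := (b p.1).comp (MonoidHom.snd G L) * (b.flip p.2)⁻¹.comp (MonoidHom.fst G L)
  map_one' := by ext; simp
  map_mul' p q := by
    ext r
    simp [mul_mul_mul_comm, mul_comm]

theorem symplectic_apply (p q : G × L) :
    symplectic b p q = b p.1 q.2 * (b q.1 p.2)⁻¹ := rfl

theorem weyl_conj (p q : G × L) :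
    weyl b p * weyl b q * star (weyl b p) = (symplectic b p q : ℂ) • weyl b q := by
  have h1 := weyl_mul b p q
  have h2 := weyl_mul b q p
  have h3 : weyl b p * weyl b q = (symplectic b p q : ℂ) • (weyl b q * weyl b p) := by
    rw [h1, h2, smul_smul, mul_comm q p, symplectic_apply, Circle.coe_mul, Circle.coe_inv,
      mul_assoc, inv_mul_cancel₀ (Circle.coe_ne_zero _), mul_one]
  rw [h3, smul_mul_assoc, mul_assoc, (Unitary.mem_iff.mp (weyl_mem_unitary b p)).2, mul_one]

theorem weyl_one : weyl b 1 = 1 := by simp [weyl]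

theorem star_weyl (p : G × L) : star (weyl b p) = (b p.1 p.2 : ℂ) • weyl b p⁻¹ := by
  have h := weyl_mul b p p⁻¹
  have h1 := (Unitary.mem_iff.mp (weyl_mem_unitary b p)).1
  rw [mul_inv_cancel, weyl_one] at h
  have h2 := congrArg (star (weyl b p) * ·) h
  simp only [← mul_assoc, h1, one_mul, mul_smul_comm, mul_one] at h2
  rw [h2, smul_smul]
  simp

/-- Products and adjoints of the `w_l u_g` are scalar multiples of such elements, so their span is a
unital `*`-subalgebra; it contains both families of generators. -/
theorem dense_weyl :
    Dense (Submodule.span ℂ (Set.range (weyl b)) : Set (DualCrossedProduct b)) := by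
  set V := Submodule.span ℂ (Set.range (weyl b)) with hV
  have hmem : ∀ p, weyl b p ∈ V := fun p => Submodule.subset_span ⟨p, rfl⟩
  have hone : (1 : DualCrossedProduct b) ∈ V := weyl_one b ▸ hmem 1
  let S : StarSubalgebra ℂ (DualCrossedProduct b) :=
    { carrier := V
      mul_mem' := fun {x y} hx hy => by
        have h1 : x * y ∈ V * V := Submodule.mul_mem_mul hx hy
        rw [hV, Submodule.span_mul_span] at h1
        refine Submodule.span_le.mpr ?_ h1
        rintro _ ⟨_, ⟨p, rfl⟩, _, ⟨q, rfl⟩, rfl⟩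
        change weyl b p * weyl b q ∈ V
        rw [weyl_mul]
        exact V.smul_mem _ (hmem _)
      add_mem' := fun hx hy => V.add_mem hx hy
      algebraMap_mem' := fun c => by
        rw [Algebra.algebraMap_eq_smul_one]
        exact V.smul_mem _ hone
      star_mem' := fun {x} hx => by
        change x ∈ V at hx
        change star x ∈ V
        induction hx using Submodule.span_induction with
        | mem x hx =>
          obtain ⟨p, rfl⟩ := hx
          rw [star_weyl]
          exact V.smul_mem _ (hmem _)
        | zero => rw [star_zero]; exact V.zero_mem
        | add x y _ _ hx hy => rw [star_add]; exact V.add_mem hx hy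
        | smul c x _ hx => rw [star_smul]; exact V.smul_mem _ hx }
  have hS : S.topologicalClosure = ⊤ := eq_top_of_mem _ S.isClosed_topologicalClosure
    (fun g => S.le_topologicalClosure (show _ ∈ V by simpa [weyl] using hmem (g, 1)))
    (fun l => S.le_topologicalClosure (show _ ∈ V by simpa [weyl] using hmem (1, l)))
  intro x
  have hx : x ∈ S.topologicalClosure := hS ▸ StarSubalgebra.mem_top
  exact hx

/-- Rescaling the `u_g` and the `w_l` by characters leaves their commutation relation intact, so the
universal property applies. -/
theorem exists_act (χ : G × L →* Circle) :
    ∃ θ : DualCrossedProduct b →⋆ₐ[ℂ] DualCrossedProduct b,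
      (∀ g, θ (uHom b g) = (χ (g, 1) : ℂ) • (uHom b g : DualCrossedProduct b)) ∧
      ∀ l, θ (wHom b l) = (χ (1, l) : ℂ) • (wHom b l : DualCrossedProduct b) := by
  have h : ∀ g l, ((scaleHom (χ.comp (MonoidHom.inl G L)) (uHom b) g : DualCrossedProduct b) *
      scaleHom (χ.comp (MonoidHom.inr G L)) (wHom b) l) = (b g l : ℂ) •
      ((scaleHom (χ.comp (MonoidHom.inr G L)) (wHom b) l : DualCrossedProduct b) *
        scaleHom (χ.comp (MonoidHom.inl G L)) (uHom b) g) := fun g l => by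
    simp only [coe_scaleHom, smul_mul_smul_comm, u_mul_w, smul_smul]
    congr 1
    ring
  exact ⟨lift _ _ h, fun g => lift_u _ _ h g, fun l => lift_w _ _ h l⟩

variable (hG : ∀ g, (∀ l, b g l = 1) → g = 1) (hL : ∀ l, (∀ g, b g l = 1) → l = 1)

/-- The unitaries `w_l u_g` as a Weyl system. -/
def weylSystem : WeylSystem (DualCrossedProduct b) (G × L) where
  v := weyl b
  b := symplectic b
  act χ := (exists_act b χ).choose
  v_one := weyl_one b
  star_mul_self p := (Unitary.mem_iff.mp (weyl_mem_unitary b p)).1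
  conj := weyl_conj b
  act_v χ p := by
    have h := (exists_act b χ).choose_spec
    rw [weyl, map_mul, h.1, h.2, smul_mul_smul_comm, ← Circle.coe_mul, ← map_mul]
    simp
  dense := dense_weyl b
  nondegenerate p hp := by
    -- Testing against `(1, l)` isolates the component in `G`, and testing against `(g, 1)` the
    -- component in `L`.
    refine Prod.ext (hG _ fun l => ?_) (hL _ fun g => ?_)
    · simpa [symplectic_apply] using hp (1, l)
    · simpa [symplectic_apply] using hp (g, 1)

include hG hL in
theorem isSimple_and_existsUnique_trace [Nontrivial (DualCrossedProduct b)] :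
    IsSimpleCStar (DualCrossedProduct b) ∧
      ∃! τ : DualCrossedProduct b →ₗ[ℂ] ℂ, IsTrace τ :=
  (weylSystem b hG hL).isSimple_and_existsUnique_trace

/-- The twist of `C*(L)` by a character of `L` extends to the crossed product, by letting the
character ignore `G`. -/
theorem injective_coeff [Nontrivial (DualCrossedProduct b)] :
    Function.Injective (coeffHom (GroupCStar.dualAction.comp b)) :=
  GroupCStar.injective_of_twist _ fun χ => by
    obtain ⟨θ, -, hθ⟩ := exists_act b (χ.comp (MonoidHom.snd G L))
    exact ⟨θ, hθ⟩

theorem injective_liftHom_u [Nontrivial (DualCrossedProduct b)] :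
    Function.Injective (GroupCStar.liftHom (uHom b)) :=
  GroupCStar.injective_of_twist _ fun χ => by
    obtain ⟨θ, hθ, -⟩ := exists_act b (χ.comp (MonoidHom.fst G L))
    exact ⟨θ, fun g => by rw [GroupCStar.liftHom_delta]; exact hθ g⟩

/-- Interchanging the two groups. -/
theorem exists_flip : ∃ E : DualCrossedProduct b.flip⁻¹ ≃⋆ₐ[ℂ] DualCrossedProduct b,
    (∀ l, E (uHom b.flip⁻¹ l) = wHom b l) ∧ ∀ g, E (wHom b.flip⁻¹ g) = uHom b g := by
  have h1 : ∀ l g, (wHom b l * uHom b g : DualCrossedProduct b) =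
      (b.flip⁻¹ l g : ℂ) • (uHom b g * wHom b l : DualCrossedProduct b) := fun l g => by
    rw [u_mul_w, smul_smul]
    simp
  have h2 : ∀ g l, (wHom b.flip⁻¹ g * uHom b.flip⁻¹ l : DualCrossedProduct b.flip⁻¹) =
      (b g l : ℂ) • (uHom b.flip⁻¹ l * wHom b.flip⁻¹ g : DualCrossedProduct b.flip⁻¹) :=
    fun g l => by
      rw [u_mul_w, smul_smul]
      simp
  refine ⟨StarAlgEquiv.ofStarAlgHom (lift _ _ h1) (lift _ _ h2)
    (hom_ext (fun l => ?_) fun g => ?_) (hom_ext (fun g => ?_) fun l => ?_),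
    lift_u _ _ h1, lift_w _ _ h1⟩
  · change lift _ _ h2 (lift _ _ h1 _) = _
    rw [lift_u, lift_w]; rfl
  · change lift _ _ h2 (lift _ _ h1 _) = _
    rw [lift_w, lift_u]; rfl
  · change lift _ _ h1 (lift _ _ h2 _) = _
    rw [lift_u, lift_w]; rfl
  · change lift _ _ h1 (lift _ _ h2 _) = _
    rw [lift_w, lift_u]; rfl

end Comm

end DualCrossedProduct

section

/-! ## The representation of `A_φ` on `ℓ²(G)` -/

section HilbertSpace

variable {ι : Type*} {E : Type*} [NormedAddCommGroup E] [InnerProductSpace ℂ E] [CompleteSpace E]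
  (b : HilbertBasis ι ℂ E) {f : ι → ι}

/-- The isometry permuting the vectors of a Hilbert basis by an injective map. -/
def shiftIsometry (hf : Function.Injective f) : E →L[ℂ] E :=
  ((b.orthonormal.comp f hf).orthogonalFamily.linearIsometry.comp
    b.repr.toLinearIsometry).toContinuousLinearMap

theorem shiftIsometry_apply (hf : Function.Injective f) (i : ι) :
    shiftIsometry b hf (b i) = b (f i) := by
  classical
  change (b.orthonormal.comp f hf).orthogonalFamily.linearIsometry (b.repr (b i)) = _
  rw [b.repr_self, OrthogonalFamily.linearIsometry_apply_single]
  simp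

theorem HilbertBasis.clm_ext {S T : E →L[ℂ] E} (h : ∀ i, S (b i) = T (b i)) : S = T := by
  refine ContinuousLinearMap.ext_on (s := Set.range b) ?_ ?_
  · rw [dense_iff_closure_eq, ← Submodule.topologicalClosure_coe, b.dense_span]; rfl
  · rintro _ ⟨i, rfl⟩
    exact h i

theorem HilbertBasis.ext_inner {x y : E} (h : ∀ i, inner ℂ (b i) x = inner ℂ (b i) y) : x = y := by
  apply b.repr.injective
  ext i
  rw [b.repr_apply_apply, b.repr_apply_apply, h]

theorem star_shiftIsometry_apply (hf : Function.Injective f) (i : ι) :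
    star (shiftIsometry b hf) (b (f i)) = b i := by
  classical
  refine HilbertBasis.ext_inner b fun j => ?_
  rw [ContinuousLinearMap.star_eq_adjoint, ContinuousLinearMap.adjoint_inner_right,
    shiftIsometry_apply, orthonormal_iff_ite.mp b.orthonormal, orthonormal_iff_ite.mp b.orthonormal]
  simp [hf.eq_iff]

theorem star_shiftIsometry_apply_of_notMem (hf : Function.Injective f) {i : ι}
    (hi : i ∉ Set.range f) : star (shiftIsometry b hf) (b i) = 0 := by
  classical
  refine HilbertBasis.ext_inner b fun j => ?_
  rw [ContinuousLinearMap.star_eq_adjoint, ContinuousLinearMap.adjoint_inner_right,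
    shiftIsometry_apply, orthonormal_iff_ite.mp b.orthonormal, inner_zero_right, if_neg]
  exact fun h => hi ⟨j, h⟩

end HilbertSpace

variable {G : Type*} [CommGroup G] (φ : G →* G)

/-- One representation on a nonzero space suffices: on `ℓ²(G)` let `u_g e_h = e_{gh}` and `s e_h =
e_{φ(h)}`. Injectivity of `φ` makes `s` an isometry, and the sum relation holds because each `k`
lies in exactly one coset of `φ(G)`, whose summand fixes `e_k` while the others kill it. -/
theorem nontrivial_endoAlgebra (hinj : Function.Injective φ) [Finite (G ⧸ φ.range)] :
    Nontrivial (EndoAlgebra φ) := by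
  classical
  let E := lp (fun _ : G => ℂ) 2
  let b : HilbertBasis G ℂ E := HilbertBasis.ofRepr (LinearIsometryEquiv.refl ℂ E)
  let u : G → E →L[ℂ] E := fun g => shiftIsometry b (mul_right_injective g)
  let s : E →L[ℂ] E := shiftIsometry b hinj
  have hu : ∀ g h, u g (b h) = b (g * h) := fun g h => shiftIsometry_apply b _ h
  have hs : ∀ h, s (b h) = b (φ h) := fun h => shiftIsometry_apply b _ h
  have hu' : ∀ g h, star (u g) (b h) = b (g⁻¹ * h) := fun g h => by
    have := star_shiftIsometry_apply b (mul_right_injective g) (g⁻¹ * h)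
    rwa [mul_inv_cancel_left] at this
  have hs' : ∀ h, star s (b (φ h)) = b h := fun h => star_shiftIsometry_apply b hinj h
  have hs0 : ∀ h, h ∉ φ.range → star s (b h) = 0 := fun h hh =>
    star_shiftIsometry_apply_of_notMem b hinj hh
  have hss : star s * s = 1 := HilbertBasis.clm_ext b fun h => by
    simp [hs, hs']
  have huu : ∀ g, star (u g) * u g = 1 := fun g => HilbertBasis.clm_ext b fun h => by
    simp [hu, hu']
  have huu' : ∀ g, u g * star (u g) = 1 := fun g => HilbertBasis.clm_ext b fun h => by
    simp [hu, hu']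
  have hnorm : ∀ T : E →L[ℂ] E, star T * T = 1 → ‖T‖ ≤ 1 := fun T hT => by
    have h : ‖T‖ * ‖T‖ = ‖(1 : E →L[ℂ] E)‖ := by rw [← CStarRing.norm_star_mul_self, hT]
    have h2 : ‖(1 : E →L[ℂ] E)‖ ≤ 1 := ContinuousLinearMap.norm_id_le
    nlinarith [norm_nonneg T]
  let gens : EndoGen G → E →L[ℂ] E := fun x => match x with
    | EndoGen.s => s
    | EndoGen.u g => u g
  have g1 : gens EndoGen.s = s := rfl
  have g2 : ∀ g, gens (EndoGen.u g) = u g := fun _ => rfl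
  have π : EndoAlgebra φ →⋆ₐ[ℂ] (E →L[ℂ] E) := UniversalCStar.lift gens
    (by
      rintro (_ | g)
      · exact hnorm _ hss
      · exact hnorm _ (huu g))
    (by
      intro x y h
      cases h with
      | isometry => simpa [FreeStarAlgebra.lift_of, map_star] using hss
      | unitary_left g => simpa [FreeStarAlgebra.lift_of, map_star] using huu g
      | unitary_right g => simpa [FreeStarAlgebra.lift_of, map_star] using huu' g
      | mul g h =>
        simp only [FreeStarAlgebra.lift_of, map_mul, g2]
        exact HilbertBasis.clm_ext b fun k => by simp [hu, mul_assoc]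
      | shift g =>
        simp only [FreeStarAlgebra.lift_of, map_mul, g1, g2]
        exact HilbertBasis.clm_ext b fun k => by simp [hu, hs]
      | sum =>
        have := Fintype.ofFinite (G ⧸ φ.range)
        rw [finsum_eq_sum_of_fintype]
        simp only [FreeStarAlgebra.lift_of, map_mul, map_sum, map_star, map_one, g1, g2]
        refine HilbertBasis.clm_ext b fun k => ?_
        rw [sum_apply, Finset.sum_eq_single (k : G ⧸ φ.range)]
        · obtain ⟨h, hh⟩ : ((k : G ⧸ φ.range).out)⁻¹ * k ∈ φ.range :=
            QuotientGroup.eq.mp (QuotientGroup.out_eq' _)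
          simp only [mul_apply_eq_comp, hu', ← hh, hs', hs, hu]
          rw [hh, mul_inv_cancel_left]; rfl
        · intro x _ hx
          have : x.out⁻¹ * k ∉ φ.range := fun h => hx (by
            rw [← QuotientGroup.eq.mpr h, QuotientGroup.out_eq'])
          simp [hu', hs0 _ this]
        · simp)
  have hE : Nontrivial (E →L[ℂ] E) := by
    refine ⟨1, 0, fun h => ?_⟩
    have h1 : b 1 = 0 := by simpa using DFunLike.congr_fun h (b 1)
    exact b.orthonormal.ne_zero 1 h1
  exact RingHom.domain_nontrivial (π : EndoAlgebra φ →+* (E →L[ℂ] E))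

end

section

variable {G : Type*} [CommGroup G] (φ : G →* G)

/-! ## Relations in `A_φ` -/

theorem star_sGen_mul_sGen : star (sGen φ) * sGen φ = 1 := by
  have := UniversalCStar.mkHom_eq_of_rel (fun _ : EndoGen G => 1) _ (EndoRel.isometry (φ := φ))
  rw [map_mul, map_star, map_one] at this
  exact this

theorem uGen_mul (g h : G) : uGen φ (g * h) = uGen φ g * uGen φ h := by
  have := UniversalCStar.mkHom_eq_of_rel (fun _ : EndoGen G => 1) _ (EndoRel.mul (φ := φ) g h)
  rw [map_mul] at this
  exact this.symm

theorem sGen_mul_uGen (g : G) : sGen φ * uGen φ g = uGen φ (φ g) * sGen φ := by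
  have := UniversalCStar.mkHom_eq_of_rel (fun _ : EndoGen G => 1) _ (EndoRel.shift (φ := φ) g)
  rw [map_mul, map_mul] at this
  exact this

theorem uGen_mem_unitary (g : G) : uGen φ g ∈ unitary (EndoAlgebra φ) := by
  have h1 := UniversalCStar.mkHom_eq_of_rel (fun _ : EndoGen G => 1) _
    (EndoRel.unitary_left (φ := φ) g)
  have h2 := UniversalCStar.mkHom_eq_of_rel (fun _ : EndoGen G => 1) _
    (EndoRel.unitary_right (φ := φ) g)
  rw [map_mul, map_star, map_one] at h1 h2
  exact ⟨h1, h2⟩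

/-- The unitary representation `g ↦ u_g` of `G` in `A_φ`. -/
def uGenHom : G →* unitary (EndoAlgebra φ) where
  toFun g := ⟨uGen φ g, uGen_mem_unitary φ g⟩
  map_one' := by
    -- `u_1 = 1` is not among the relations; it follows since an idempotent in the unitary group is
    -- trivial.
    have h : (⟨uGen φ 1, uGen_mem_unitary φ 1⟩ : unitary (EndoAlgebra φ)) *
        ⟨uGen φ 1, uGen_mem_unitary φ 1⟩ = ⟨uGen φ 1, uGen_mem_unitary φ 1⟩ :=
      Subtype.ext (by rw [Submonoid.coe_mul, ← uGen_mul, mul_one])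
    exact mul_eq_left.mp h
  map_mul' g h := Subtype.ext (uGen_mul φ g h)

theorem uGen_one : uGen φ 1 = 1 := congrArg Subtype.val (map_one (uGenHom φ))

theorem star_uGen (g : G) : star (uGen φ g) = uGen φ g⁻¹ :=
  (congrArg Subtype.val (map_inv (uGenHom φ) g)).symm

theorem sum_uGen [Fintype (G ⧸ φ.range)] :
    ∑ x : G ⧸ φ.range, uGen φ x.out * sGen φ * star (sGen φ) * star (uGen φ x.out) = 1 := by
  have := UniversalCStar.mkHom_eq_of_rel (fun _ : EndoGen G => 1) _ (EndoRel.sum (φ := φ))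
  rw [finsum_eq_sum_of_fintype, map_sum, map_one] at this
  rw [← this]
  simp only [map_mul, map_star]
  rfl

theorem sGen_pow_mul_uGen (n : ℕ) (g : G) :
    sGen φ ^ n * uGen φ g = uGen φ (φ^[n] g) * sGen φ ^ n := by
  induction n generalizing g with
  | zero => simp
  | succ n ih =>
    rw [pow_succ, mul_assoc, sGen_mul_uGen, ← mul_assoc, ih, mul_assoc]; rfl

theorem uGen_mul_star_sGen_pow (n : ℕ) (g : G) :
    uGen φ g * star (sGen φ) ^ n = star (sGen φ) ^ n * uGen φ (φ^[n] g) := by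
  have := congrArg star (sGen_pow_mul_uGen φ n g⁻¹)
  simp only [star_mul, star_pow, star_uGen, inv_inv, iterate_map_inv] at this
  exact this

theorem star_sGen_pow_mul_sGen_pow (n : ℕ) : star (sGen φ) ^ n * sGen φ ^ n = 1 := by
  induction n with
  | zero => simp
  | succ n ih =>
    rw [pow_succ, pow_succ', mul_assoc, ← mul_assoc (star (sGen φ)), star_sGen_mul_sGen, one_mul,
      ih]

/-! ## The projections -/

theorem proj_eq (n : ℕ) (g : G) :
    proj φ n g = uGen φ g * sGen φ ^ n * (star (sGen φ) ^ n * uGen φ g⁻¹) := by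
  rw [proj, star_uGen, mul_assoc]

theorem star_proj (n : ℕ) (g : G) : star (proj φ n g) = proj φ n g := by
  simp [proj, mul_assoc]

theorem proj_mul_proj_eq (m n : ℕ) (g h : G) : proj φ m g * proj φ n h =
    uGen φ g * sGen φ ^ m * (star (sGen φ) ^ m * uGen φ (g⁻¹ * h) * sGen φ ^ n) *
      (star (sGen φ) ^ n * uGen φ h⁻¹) := by
  rw [proj_eq, proj_eq, uGen_mul]
  simp only [mul_assoc]

theorem proj_mul_self (n : ℕ) (g : G) : proj φ n g * proj φ n g = proj φ n g := by
  rw [proj_mul_proj_eq, inv_mul_cancel, uGen_one, mul_one, star_sGen_pow_mul_sGen_pow, mul_one,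
    proj_eq]

/-- The algebraic form of `gφⁿ⁺¹(G) ⊆ gφⁿ(G)`. -/
theorem proj_mul_proj_succ (n : ℕ) (g : G) :
    proj φ n g * proj φ (n + 1) g = proj φ (n + 1) g := by
  rw [proj_mul_proj_eq, inv_mul_cancel, uGen_one, mul_one, pow_succ, ← mul_assoc (_ ^ n),
    star_sGen_pow_mul_sGen_pow, one_mul, proj_eq]
  simp only [pow_succ, mul_assoc]

/-- Moved through `sⁿ`, the unitary of `φ^[n] h` becomes `u_h` and cancels against its inverse from
the other side. -/
theorem proj_mul_iterate (n : ℕ) (g h : G) : proj φ n (g * φ^[n] h) = proj φ n g := by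
  have h1 : uGen φ (φ^[n] h) * sGen φ ^ n * (star (sGen φ) ^ n * uGen φ (φ^[n] h)⁻¹) =
      sGen φ ^ n * star (sGen φ) ^ n := by
    rw [← sGen_pow_mul_uGen, ← iterate_map_inv, ← uGen_mul_star_sGen_pow, mul_assoc,
      ← mul_assoc (uGen φ h), ← uGen_mul, mul_inv_cancel, uGen_one, one_mul]
  rw [proj_eq, proj_eq, uGen_mul, mul_inv, mul_comm g⁻¹, uGen_mul]
  calc _ = uGen φ g * (uGen φ (φ^[n] h) * sGen φ ^ n *
        (star (sGen φ) ^ n * uGen φ (φ^[n] h)⁻¹)) * uGen φ g⁻¹ := by simp only [mul_assoc]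
    _ = _ := by rw [h1]; simp only [mul_assoc]

theorem proj_congr {n : ℕ} {g h : G} (hgh : (g : G ⧸ powRange φ n) = h) :
    proj φ n g = proj φ n h := by
  obtain ⟨k, hk⟩ := QuotientGroup.eq.mp hgh
  rw [← mul_inv_cancel_left g h, ← hk, proj_mul_iterate]

/-! ### Refinement, orthogonality and commutation of the projections -/

section Finite

variable [Finite (G ⧸ φ.range)]

/-- The sum relation is inserted between `sⁿ` and `s*ⁿ`, and each `u_x` is moved outwards as the
unitary of `φ^[n] x`. -/
theorem proj_eq_sum [Fintype (G ⧸ φ.range)] (n : ℕ) (g : G) :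
    proj φ n g = ∑ x : G ⧸ φ.range, proj φ (n + 1) (g * φ^[n] x.out) := by
  have h : ∀ x : G ⧸ φ.range, proj φ (n + 1) (g * φ^[n] x.out) = uGen φ g * sGen φ ^ n *
      (uGen φ x.out * sGen φ * star (sGen φ) * star (uGen φ x.out)) *
        (star (sGen φ) ^ n * uGen φ g⁻¹) := fun x => by
    rw [proj_eq, uGen_mul, mul_inv, mul_comm g⁻¹, uGen_mul, ← iterate_map_inv, star_uGen]
    calc _ = uGen φ g * (uGen φ (φ^[n] x.out) * sGen φ ^ n) * sGen φ * (star (sGen φ) *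
          (star (sGen φ) ^ n * uGen φ (φ^[n] x.out⁻¹)) * uGen φ g⁻¹) := by
            rw [pow_succ, pow_succ']; simp only [mul_assoc]
      _ = _ := by
        rw [← sGen_pow_mul_uGen, ← uGen_mul_star_sGen_pow]; simp only [mul_assoc]
  simp only [h]
  rw [← Finset.sum_mul, ← Finset.mul_sum, sum_uGen, mul_one, proj_eq]

/-- The level-one projections sum to `1`. Compressing this sum by `p = proj φ 1 1` gives `p`, which
the term of the trivial coset already provides; the other terms `p q p` are positive with sum zero,
so each `q p` vanishes. -/
theorem star_sGen_mul_uGen_mul_sGen {g : G} (hg : g ∉ φ.range) :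
    star (sGen φ) * uGen φ g * sGen φ = 0 := by
  classical
  let _ : PartialOrder (EndoAlgebra φ) := CStarAlgebra.spectralOrder _
  let _ : StarOrderedRing (EndoAlgebra φ) := CStarAlgebra.spectralOrderedRing _
  have := Fintype.ofFinite (G ⧸ φ.range)
  have hsum := proj_eq_sum φ 0 1
  have h0 : proj φ 0 1 = 1 := by simp [proj, uGen_one]
  simp only [h0, zero_add, one_mul, Function.iterate_zero, id_eq] at hsum
  set y : G ⧸ φ.range := ((1 : G) : G ⧸ φ.range) with hy
  have hrange : ∀ {a b : G}, (a : G ⧸ φ.range) = b → proj φ 1 a = proj φ 1 b := fun {a b} hab => by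
    obtain ⟨k, hk⟩ := QuotientGroup.eq.mp hab
    rw [← mul_inv_cancel_left a b, ← hk]
    exact (proj_mul_iterate φ 1 a k).symm
  have hexp : ∑ x : G ⧸ φ.range, proj φ 1 1 * proj φ 1 x.out * proj φ 1 1 = proj φ 1 1 := by
    rw [← Finset.sum_mul, ← Finset.mul_sum, ← hsum, mul_one, proj_mul_self]
  have hy1 : proj φ 1 y.out = proj φ 1 1 := hrange (QuotientGroup.out_eq' y)
  rw [← Finset.add_sum_erase _ _ (Finset.mem_univ y), hy1, proj_mul_self, proj_mul_self,
    add_eq_left] at hexp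
  have hsq : ∀ x, proj φ 1 1 * proj φ 1 x * proj φ 1 1 =
      star (proj φ 1 x * proj φ 1 1) * (proj φ 1 x * proj φ 1 1) := fun x => by
    rw [star_mul, star_proj, star_proj, mul_assoc, mul_assoc, ← mul_assoc (proj φ 1 x),
      proj_mul_self]
  -- With the coset of `g⁻¹`, the middle factor of the vanishing product is `s* u_g s`.
  have hz := (Finset.sum_eq_zero_iff_of_nonneg fun x _ => by
    rw [hsq]; exact star_mul_self_nonneg _).mp hexp (g⁻¹ : G) (Finset.mem_erase.mpr ⟨fun h => by
      rw [hy, QuotientGroup.eq] at h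
      exact hg (by simpa using h), Finset.mem_univ _⟩)
  rw [hsq, CStarRing.star_mul_self_eq_zero_iff, hrange (QuotientGroup.out_eq' _),
    proj_mul_proj_eq] at hz
  have h2 := congrArg (fun z => star (sGen φ) * uGen φ g * z * sGen φ) hz
  simp only [pow_one, inv_inv, mul_one, mul_zero, zero_mul, inv_one, uGen_one] at h2
  rw [← h2]
  have e1 : uGen φ g * uGen φ g⁻¹ = 1 := by rw [← uGen_mul, mul_inv_cancel, uGen_one]
  calc _ = (star (sGen φ) * (1 : EndoAlgebra φ) * sGen φ) * (star (sGen φ) * uGen φ g * sGen φ) *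
      (star (sGen φ) * sGen φ) := by
        rw [mul_one, star_sGen_mul_sGen, one_mul, mul_one]
    _ = _ := by
      rw [← e1]; simp only [mul_assoc]

/-- Peel off the innermost `s* u_g s`: it is `0` if `g ∉ φ(G)`, and `u_k` if `g = φ(k)`, where `k`
again avoids the range one level lower. -/
theorem star_sGen_pow_mul_uGen_mul_sGen_pow {n : ℕ} {g : G} (hg : g ∉ powRange φ n) :
    star (sGen φ) ^ n * uGen φ g * sGen φ ^ n = 0 := by
  induction n generalizing g with
  | zero => exact absurd ⟨g, rfl⟩ hg
  | succ n ih =>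
    have h1 : star (sGen φ) ^ (n + 1) * uGen φ g * sGen φ ^ (n + 1) =
        star (sGen φ) ^ n * (star (sGen φ) * uGen φ g * sGen φ) * sGen φ ^ n := by
      rw [pow_succ, pow_succ']; simp only [mul_assoc]
    rw [h1]
    by_cases h : g ∈ φ.range
    · obtain ⟨k, rfl⟩ := h
      rw [mul_assoc (star (sGen φ)), ← sGen_mul_uGen, ← mul_assoc (star (sGen φ)),
        star_sGen_mul_sGen, one_mul]
      refine ih fun hk => hg ?_
      rw [powRange_succ]
      exact ⟨k, hk, rfl⟩
    · rw [star_sGen_mul_uGen_mul_sGen φ h, mul_zero, zero_mul]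

theorem proj_mul_proj_of_ne {n : ℕ} {g h : G} (hgh : (g : G ⧸ powRange φ n) ≠ h) :
    proj φ n g * proj φ n h = 0 := by
  rw [proj_mul_proj_eq, star_sGen_pow_mul_uGen_mul_sGen_pow φ
    (fun hmem => hgh (QuotientGroup.eq.mpr hmem)), mul_zero, zero_mul]

theorem proj_commute_level (n : ℕ) (g h : G) : Commute (proj φ n g) (proj φ n h) := by
  by_cases hgh : (g : G ⧸ powRange φ n) = h
  · rw [proj_congr φ hgh]
  · rw [Commute, SemiconjBy, proj_mul_proj_of_ne φ hgh, proj_mul_proj_of_ne φ (Ne.symm hgh)]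

theorem proj_mem_span_of_le {m n : ℕ} (hmn : m ≤ n) (g : G) :
    proj φ m g ∈ Submodule.span ℂ (Set.range (proj φ n)) := by
  have := Fintype.ofFinite (G ⧸ φ.range)
  induction n, hmn using Nat.le_induction with
  | base => exact Submodule.subset_span ⟨g, rfl⟩
  | succ n _ ih =>
    refine Submodule.span_le.mpr ?_ ih
    rintro _ ⟨h, rfl⟩
    rw [proj_eq_sum]
    exact Submodule.sum_mem _ fun x _ => Submodule.subset_span ⟨_, rfl⟩

/-- Both projections are combinations of those at level `max m n`, and two projections of one level
are equal or orthogonal. -/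
theorem proj_commute (m n : ℕ) (g h : G) : Commute (proj φ m g) (proj φ n h) := by
  have key : ∀ {x y : EndoAlgebra φ} {k : ℕ}, x ∈ Submodule.span ℂ (Set.range (proj φ k)) →
      y ∈ Submodule.span ℂ (Set.range (proj φ k)) → Commute x y := fun {x y k} hx hy => by
    induction hx using Submodule.span_induction with
    | mem x hx =>
      obtain ⟨a, rfl⟩ := hx
      induction hy using Submodule.span_induction with
      | mem y hy => obtain ⟨b, rfl⟩ := hy; exact proj_commute_level φ k a b
      | zero => exact Commute.zero_right _
      | add y z _ _ hy hz => exact hy.add_right hz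
      | smul c y _ hy => exact hy.smul_right c
    | zero => exact Commute.zero_left _
    | add x z _ _ hx hz => exact hx.add_left hz
    | smul c x _ hx => exact hx.smul_left c
  exact key (proj_mem_span_of_le φ (le_max_left m n) g) (proj_mem_span_of_le φ (le_max_right m n) h)

end Finite

end

section

variable {G : Type*} [CommGroup G] (φ : G →* G)

/-! ## The homomorphism on `C(K)` -/

theorem isClosed_cstarGen {A : Type*} [CStarAlgebra A] (S : Set A) :
    IsClosed (cstarGen S : Set A) :=
  StarSubalgebra.isClosed_topologicalClosure _

theorem subset_cstarGen {A : Type*} [CStarAlgebra A] (S : Set A) : S ⊆ cstarGen S :=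
  (StarAlgebra.subset_adjoin ℂ S).trans (StarSubalgebra.le_topologicalClosure _)

theorem cstarGen_le {A : Type*} [CStarAlgebra A] {S : Set A} {B : StarSubalgebra ℂ A}
    (hB : IsClosed (B : Set A)) (h : S ⊆ B) : cstarGen S ≤ B :=
  StarSubalgebra.topologicalClosure_minimal (StarAlgebra.adjoin_le h) hB

/-- Centralizers are closed `*`-subalgebras. One such argument shows that `S` commutes with the
generated algebra, a second that this algebra commutes with itself. -/
theorem cstarGen_mul_comm {A : Type*} [CStarAlgebra A] {S : Set A} (hsa : ∀ x ∈ S, star x = x)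
    (hS : ∀ x ∈ S, ∀ y ∈ S, x * y = y * x) {x y : A} (hx : x ∈ cstarGen S)
    (hy : y ∈ cstarGen S) : x * y = y * x := by
  have h1 : ∀ z ∈ cstarGen S, ∀ s ∈ S, s * z = z * s := fun z hz s hs => by
    have hle : cstarGen S ≤ StarSubalgebra.centralizer ℂ S :=
      cstarGen_le (Set.isClosed_centralizer _) fun t ht => by
        refine (StarSubalgebra.mem_centralizer_iff ℂ).mpr fun r hr => ?_
        rw [hsa r hr]
        exact ⟨hS r hr t ht, hS r hr t ht⟩
    exact ((StarSubalgebra.mem_centralizer_iff ℂ).mp (hle hz) s hs).1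
  have h2 : ∀ z ∈ cstarGen S, star z ∈ cstarGen S := fun z hz => star_mem hz
  have hle : cstarGen S ≤ StarSubalgebra.centralizer ℂ {y} :=
    cstarGen_le (Set.isClosed_centralizer _) fun s hs => by
      refine (StarSubalgebra.mem_centralizer_iff ℂ).mpr ?_
      rintro _ rfl
      exact ⟨(h1 _ hy s hs).symm, (h1 _ (h2 _ hy) s hs).symm⟩
  exact ((StarSubalgebra.mem_centralizer_iff ℂ).mp (hle hx) y rfl).1.symm

/-! ### The characters of the algebra generated by the projections -/

section Finite

variable [Finite (G ⧸ φ.range)]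

/-- The C*-algebra generated by the projections is commutative. -/
abbrev commCStarAlgebraCK : CommCStarAlgebra (subalgCK φ) :=
  { StarSubalgebra.cstarAlgebra (subalgCK φ) (h_closed := isClosed_cstarGen _) with
    mul_comm := fun x y => Subtype.ext (cstarGen_mul_comm
      (by rintro _ ⟨⟨n, g⟩, rfl⟩; exact star_proj φ n g)
      (by rintro _ ⟨⟨n, g⟩, rfl⟩ _ ⟨⟨m, h⟩, rfl⟩; exact proj_commute φ n m g h) x.2 y.2) }

attribute [local instance] commCStarAlgebraCK

/-- The projection `u_g sⁿ s*ⁿ u_g*`, as an element of `subalgCK φ`. -/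
def projCK (n : ℕ) (g : G) : subalgCK φ := ⟨proj φ n g, subset_cstarGen _ ⟨(n, g), rfl⟩⟩

open WeakDual

variable {φ} in
theorem char_projCK_eq_one (τ : characterSpace ℂ (subalgCK φ)) {n : ℕ} {g : G}
    (h : τ (projCK φ n g) ≠ 0) : τ (projCK φ n g) = 1 := by
  have h1 : projCK φ n g * projCK φ n g = projCK φ n g := Subtype.ext (proj_mul_self φ n g)
  have h2 := congrArg τ h1
  rw [map_mul] at h2
  exact mul_eq_left₀ h |>.mp h2

variable {φ}

/-- At level `0` the projection is `1`. A nonzero value at level `n` is a sum of values at level `n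
+ 1`, so one of those is nonzero. -/
theorem exists_char_projCK_ne_zero (τ : characterSpace ℂ (subalgCK φ)) (n : ℕ) :
    ∃ g, τ (projCK φ n g) ≠ 0 := by
  have := Fintype.ofFinite (G ⧸ φ.range)
  induction n with
  | zero =>
    refine ⟨1, ?_⟩
    have : projCK φ 0 1 = 1 := Subtype.ext (by simp [projCK, proj, uGen_one])
    rw [this, map_one]
    exact one_ne_zero
  | succ n ih =>
    obtain ⟨g, hg⟩ := ih
    have h : projCK φ n g = ∑ x : G ⧸ φ.range, projCK φ (n + 1) (g * φ^[n] x.out) :=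
      Subtype.ext (by
        rw [AddSubmonoidClass.coe_finsetSum]
        exact proj_eq_sum φ n g)
    rw [h, map_sum] at hg
    obtain ⟨x, -, hx⟩ := Finset.exists_ne_zero_of_sum_ne_zero hg
    exact ⟨_, hx⟩

theorem char_projCK_congr (τ : characterSpace ℂ (subalgCK φ)) {n : ℕ} {g h : G}
    (hg : τ (projCK φ n g) ≠ 0) (hh : τ (projCK φ n h) ≠ 0) :
    (g : G ⧸ powRange φ n) = h := by
  by_contra hne
  have h1 : projCK φ n g * projCK φ n h = 0 := Subtype.ext (proj_mul_proj_of_ne φ hne)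
  have h2 := congrArg τ h1
  rw [map_mul, map_zero] at h2
  exact (mul_ne_zero hg hh) h2

/-- The point of `K` given by a character of `subalgCK φ`. -/
def charPoint (τ : characterSpace ℂ (subalgCK φ)) : adicCompletion φ :=
  ⟨fun n => ((exists_char_projCK_ne_zero τ n).choose : G ⧸ powRange φ n), fun n => by
    have h := (exists_char_projCK_ne_zero τ (n + 1)).choose_spec
    set g := (exists_char_projCK_ne_zero τ (n + 1)).choose
    refine char_projCK_congr (g := g) τ (fun h0 => h ?_)
      (exists_char_projCK_ne_zero τ n).choose_spec
    have h1 : projCK φ n g * projCK φ (n + 1) g = projCK φ (n + 1) g :=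
      Subtype.ext (proj_mul_proj_succ φ n g)
    rw [← h1, map_mul, h0, zero_mul]⟩

theorem charPoint_apply_eq_iff (τ : characterSpace ℂ (subalgCK φ)) (n : ℕ) (g : G) :
    (charPoint τ).1 n = (g : G ⧸ powRange φ n) ↔ τ (projCK φ n g) ≠ 0 := by
  have h := (exists_char_projCK_ne_zero τ n).choose_spec
  constructor
  · intro hg
    have : projCK φ n g = projCK φ n (exists_char_projCK_ne_zero τ n).choose :=
      Subtype.ext (proj_congr φ hg.symm)
    rwa [this]
  · exact fun hg => char_projCK_congr τ h hg

variable [TopologicalSpace G] [DiscreteTopology G]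

/-- The condition that the `n`-th coordinate be a given coset says that one Gelfand transform is
nonzero, which is open. -/
theorem continuous_charPoint : Continuous (charPoint (φ := φ)) := by
  refine Continuous.subtype_mk (continuous_pi fun n => continuous_discrete_rng.mpr fun x => ?_) _
  obtain ⟨g, rfl⟩ := QuotientGroup.mk_surjective x
  have : (fun τ : characterSpace ℂ (subalgCK φ) => (charPoint τ).1 n) ⁻¹' {↑g} =
      {τ | τ (projCK φ n g) ≠ 0} := Set.ext fun τ => charPoint_apply_eq_iff τ n g
  change IsOpen ((fun τ : characterSpace ℂ (subalgCK φ) => (charPoint τ).1 n) ⁻¹' {↑g})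
  rw [this]
  exact isOpen_ne_fun (gelfandTransform ℂ (subalgCK φ) (projCK φ n g)).continuous
    continuous_const

variable (φ)

/-- The homomorphism `C(K) → A_φ`. -/
def homCK : C(adicCompletion φ, ℂ) →⋆ₐ[ℂ] EndoAlgebra φ :=
  -- Only the map from characters to `K` is needed here; injectivity of the result comes later, from
  -- simplicity.
  (subalgCK φ).subtype.comp
    ((StarAlgHomClass.toStarAlgHom (gelfandStarTransform (subalgCK φ)).symm).comp
      (ContinuousMap.compStarAlgHom' ℂ ℂ ⟨charPoint (φ := φ), continuous_charPoint⟩))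

theorem homCK_mem (f : C(adicCompletion φ, ℂ)) : homCK φ f ∈ subalgCK φ :=
  Subtype.property _

/-- On the character space both functions take only the values `0` and `1`, with the same support by
`charPoint_apply_eq_iff`. -/
theorem homCK_cosetIndicator (n : ℕ) (g : G) :
    homCK φ (cosetIndicator φ n g) = proj φ n g := by
  have h : gelfandStarTransform (subalgCK φ) (projCK φ n g) =
      (cosetIndicator φ n g).comp ⟨charPoint (φ := φ), continuous_charPoint⟩ := by
    ext τ
    have e1 : gelfandStarTransform (subalgCK φ) (projCK φ n g) τ = τ (projCK φ n g) := rfl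
    have e2 : (cosetIndicator φ n g).comp ⟨charPoint (φ := φ), continuous_charPoint⟩ τ =
      Set.indicator {(g : G ⧸ powRange φ n)} (fun _ => (1 : ℂ)) ((charPoint τ).1 n) := rfl
    rw [e1, e2]
    by_cases hτ : τ (projCK φ n g) = 0
    · rw [Set.indicator_of_notMem, hτ]
      exact fun hmem => (charPoint_apply_eq_iff τ n g).mp hmem hτ
    · rw [Set.indicator_of_mem, char_projCK_eq_one τ hτ]
      exact (charPoint_apply_eq_iff τ n g).mpr hτ
  change (((gelfandStarTransform (subalgCK φ)).symm ((cosetIndicator φ n g).comp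
    ⟨charPoint (φ := φ), continuous_charPoint⟩) : subalgCK φ) : EndoAlgebra φ) = _
  rw [← h, StarAlgEquiv.symm_apply_apply]
  rfl

end Finite

/-! ## The characters of `K` -/

section Characters

variable {φ}

theorem adicCompletion_eq_of_le {k : adicCompletion φ} {m n : ℕ} (hmn : m ≤ n) {g : G}
    (hg : k.1 n = (g : G ⧸ powRange φ n)) : k.1 m = (g : G ⧸ powRange φ m) := by
  induction n, hmn using Nat.le_induction with
  | base => exact hg
  | succ n _ ih => exact ih (by rw [← k.2 n, hg]; rfl)

variable [TopologicalSpace G] [DiscreteTopology G]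

theorem dualEndo_iterate_apply (n : ℕ) (χ : PontryaginDual G) (g : G) :
    ((dualEndo φ)^[n] χ) g = χ (φ^[n] g) := by
  induction n generalizing χ with
  | zero => rfl
  | succ n ih => rw [Function.iterate_succ_apply, ih, Function.iterate_succ_apply']; rfl

theorem mem_kerUnion_iff {χ : PontryaginDual G} :
    χ ∈ kerUnion φ ↔ ∃ n, ∀ g ∈ powRange φ n, χ g = 1 := by
  refine exists_congr fun n => ⟨?_, fun h => ?_⟩
  · rintro h _ ⟨g, rfl⟩
    rw [← dualEndo_iterate_apply, h]; rfl
  · exact PontryaginDual.ext fun g => by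
      rw [dualEndo_iterate_apply]; exact h _ ⟨g, rfl⟩

/-- A level through which `l` factors. -/
def level (l : kerUnion φ) : ℕ := (mem_kerUnion_iff.mp l.2).choose

theorem apply_eq_one_of_mem_powRange_level (l : kerUnion φ) {g : G}
    (hg : g ∈ powRange φ (level l)) : l.1 g = 1 :=
  (mem_kerUnion_iff.mp l.2).choose_spec g hg

theorem apply_eq_of_mk_eq {χ : PontryaginDual G} {n : ℕ} (h : ∀ g ∈ powRange φ n, χ g = 1)
    {a b : G} (hab : (a : G ⧸ powRange φ n) = b) : χ a = χ b := by
  have := h _ (QuotientGroup.eq.mp hab)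
  rw [map_mul, map_inv] at this
  exact (inv_mul_eq_one.mp this)

/-- The continuous extension of `g ↦ ⟨g | l⟩⁻¹` to `K`. -/
def conjChar (l : kerUnion φ) (k : adicCompletion φ) : Circle :=
  (l.1 (k.1 (level l)).out)⁻¹

/-- Frees `conjChar` from its chosen level and representative: both expressions are compared at the
larger of the two levels. -/
theorem conjChar_eq (l : kerUnion φ) {k : adicCompletion φ} {n : ℕ}
    (hn : ∀ g ∈ powRange φ n, l.1 g = 1) {g : G} (hg : k.1 n = (g : G ⧸ powRange φ n)) :
    conjChar l k = (l.1 g)⁻¹ := by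
  obtain ⟨h, hh⟩ := QuotientGroup.mk_surjective (k.1 (max n (level l)))
  have h1 := adicCompletion_eq_of_le (le_max_left n (level l)) hh.symm
  have h2 := adicCompletion_eq_of_le (le_max_right n (level l)) hh.symm
  rw [conjChar, apply_eq_of_mk_eq hn (hg.symm.trans h1),
    apply_eq_of_mk_eq (fun _ => apply_eq_one_of_mem_powRange_level l)
      ((QuotientGroup.out_eq' _).trans h2)]

/-- The levels chosen for `l`, `m` and `l * m` are unrelated, so all three values are computed at a
common level. -/
theorem conjChar_mul_left (l m : kerUnion φ) (k : adicCompletion φ) :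
    conjChar (l * m) k = conjChar l k * conjChar m k := by
  set N := max (level l) (level m)
  obtain ⟨h, hh⟩ := QuotientGroup.mk_surjective (k.1 N)
  have hle : ∀ {n}, n ≤ N → powRange φ N ≤ powRange φ n := fun {n} hn =>
    antitone_nat_of_succ_le (powRange_succ_le φ) hn
  have hl : ∀ g ∈ powRange φ N, l.1 g = 1 := fun g hg =>
    apply_eq_one_of_mem_powRange_level l (hle (le_max_left _ _) hg)
  have hm : ∀ g ∈ powRange φ N, m.1 g = 1 := fun g hg =>
    apply_eq_one_of_mem_powRange_level m (hle (le_max_right _ _) hg)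
  rw [conjChar_eq l hl hh.symm, conjChar_eq m hm hh.symm,
    conjChar_eq (l * m) (n := N) (fun g hg => ?_) hh.symm, ← mul_inv]
  · rfl
  · change l.1 g * m.1 g = 1
    rw [hl g hg, hm g hg, one_mul]

theorem conjChar_mul_right (l : kerUnion φ) (k k' : adicCompletion φ) :
    conjChar l (k * k') = conjChar l k * conjChar l k' := by
  have h := fun g => apply_eq_one_of_mem_powRange_level (g := g) l
  obtain ⟨g, hg⟩ := QuotientGroup.mk_surjective (k.1 (level l))
  obtain ⟨g', hg'⟩ := QuotientGroup.mk_surjective (k'.1 (level l))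
  rw [conjChar_eq l h hg.symm, conjChar_eq l h hg'.symm, conjChar_eq l h (g := g * g'),
    ← mul_inv, ← map_mul]
  change k.1 _ * k'.1 _ = _
  rw [← hg, ← hg']; rfl

theorem conjChar_toCompletion (l : kerUnion φ) (g : G) :
    conjChar l (toCompletion φ g) = (pairing φ g l)⁻¹ :=
  conjChar_eq l (fun _ => apply_eq_one_of_mem_powRange_level l) rfl

/-- The function `f_l` on `K`. -/
def conjCharFun (l : kerUnion φ) : C(adicCompletion φ, ℂ) where
  toFun k := conjChar l k
  continuous_toFun := (continuous_of_discreteTopology (α := G ⧸ powRange φ (level l))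
    (f := fun x => (((l.1 x.out)⁻¹ : Circle) : ℂ))).comp
      ((continuous_apply _).comp continuous_subtype_val)

/-- `l ↦ f_l` as a unitary representation. -/
def conjCharHom (φ : G →* G) [Finite (G ⧸ φ.range)] :
    kerUnion φ →* unitary C(adicCompletion φ, ℂ) where
  toFun l := ⟨conjCharFun l, by
    have h : ∀ k, star (conjCharFun l k) * conjCharFun l k = 1 := fun k => by
      change star (conjChar l k : ℂ) * conjChar l k = 1
      rw [Complex.star_def, ← Circle.coe_inv_eq_conj, ← Circle.coe_mul, inv_mul_cancel,
        Circle.coe_one]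
    exact ⟨ContinuousMap.ext h, ContinuousMap.ext fun k => (mul_comm _ _).trans (h k)⟩⟩
  map_one' := Subtype.ext (ContinuousMap.ext fun k => by
    change (conjChar 1 k : ℂ) = 1
    simp [conjChar])
  map_mul' l m := Subtype.ext (ContinuousMap.ext fun k => by
    change (conjChar (l * m) k : ℂ) = conjChar l k * conjChar m k
    rw [conjChar_mul_left, Circle.coe_mul])

/-- Complex characters of the finite abelian group `G/φⁿ(G)` separate its points; their values have
finite order and so lie on the circle. -/
theorem exists_kerUnion_apply_ne_one [Finite (G ⧸ φ.range)] {n : ℕ} {g : G}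
    (hg : g ∉ powRange φ n) : ∃ l : kerUnion φ, (∀ x ∈ powRange φ n, l.1 x = 1) ∧ l.1 g ≠ 1 := by
  obtain ⟨χ, hχ⟩ := CommGroup.exists_apply_ne_one_of_hasEnoughRootsOfUnity
    (G ⧸ powRange φ n) ℂ (a := (g : G ⧸ powRange φ n))
    (fun h => hg ((QuotientGroup.eq_one_iff g).mp h))
  have hnorm : ∀ x, ‖(χ x : ℂ)‖ = 1 := fun x => by
    refine (pow_eq_one_iff_of_nonneg (norm_nonneg _)
      (Nat.card_pos (α := G ⧸ powRange φ n)).ne').mp ?_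
    rw [← norm_pow, ← Units.val_pow_eq_pow_val, ← map_pow, pow_card_eq_one', map_one,
      Units.val_one, norm_one]
  let ψ : G →* Circle :=
    { toFun := fun x => ⟨χ (x : G ⧸ powRange φ n), mem_sphere_zero_iff_norm.mpr (hnorm _)⟩
      map_one' := Circle.ext (by simp)
      map_mul' := fun x y => Circle.ext (by simp; rfl) }
  have h1 : ∀ x ∈ powRange φ n, ψ x = 1 := fun x hx => Circle.ext (by
    change (χ (x : G ⧸ powRange φ n) : ℂ) = 1
    rw [(QuotientGroup.eq_one_iff x).mpr hx, map_one, Units.val_one])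
  let ψ' : PontryaginDual G := ⟨ψ, continuous_of_discreteTopology⟩
  refine ⟨⟨ψ', mem_kerUnion_iff.mpr ⟨n, h1⟩⟩, h1, fun h => hχ (Units.ext ?_)⟩
  exact congrArg (Subtype.val) h

theorem exists_conjChar_ne [Finite (G ⧸ φ.range)] {k k' : adicCompletion φ} (h : k ≠ k') :
    ∃ l : kerUnion φ, conjChar l k ≠ conjChar l k' := by
  obtain ⟨n, hn⟩ : ∃ n, k.1 n ≠ k'.1 n := by
    by_contra! hn
    exact h (Subtype.ext (funext hn))
  obtain ⟨g, hg⟩ := QuotientGroup.mk_surjective (k.1 n)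
  obtain ⟨g', hg'⟩ := QuotientGroup.mk_surjective (k'.1 n)
  obtain ⟨l, hl, hl'⟩ := exists_kerUnion_apply_ne_one (φ := φ) (n := n) (g := g⁻¹ * g')
    (fun hmem => hn (by rw [← hg, ← hg']; exact QuotientGroup.eq.mpr hmem))
  refine ⟨l, fun heq => hl' ?_⟩
  rw [conjChar_eq l hl hg.symm, conjChar_eq l hl hg'.symm] at heq
  rw [map_mul, map_inv, inv_mul_eq_one, inv_injective heq]

end Characters

end

section

/-! ## Isomorphisms onto C*-subalgebras -/

section General

variable {A C : Type*} [CStarAlgebra A] [CStarAlgebra C]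

theorem coe_range_starAlgHom (f : A →⋆ₐ[ℂ] C) : (f.range : Set C) = Set.range f := rfl

theorem isClosed_range_of_injective {f : A →⋆ₐ[ℂ] C} (hf : Function.Injective f) :
    IsClosed (f.range : Set C) := by
  rw [coe_range_starAlgHom]
  exact (NonUnitalStarAlgHom.isometry f hf).isClosedEmbedding.isClosed_range

theorem injective_of_isSimpleCStar [Nontrivial C] (hA : IsSimpleCStar A) (f : A →⋆ₐ[ℂ] C) :
    Function.Injective f := by
  have hcl : IsClosed (TwoSidedIdeal.ker f : Set A) := by
    have : (TwoSidedIdeal.ker f : Set A) = f ⁻¹' {0} := Set.ext fun x => by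
      simp [TwoSidedIdeal.mem_ker]
    rw [this]
    exact isClosed_singleton.preimage (continuous_starAlgHom f)
  rcases hA.2 _ hcl with h | h
  · rw [injective_iff_map_eq_zero]
    intro x hx
    have h1 : x ∈ TwoSidedIdeal.ker f := (TwoSidedIdeal.mem_ker f).mpr hx
    rwa [h, TwoSidedIdeal.mem_bot] at h1
  · have h1 : (1 : A) ∈ TwoSidedIdeal.ker f := h ▸ trivial
    rw [TwoSidedIdeal.mem_ker, map_one] at h1
    exact absurd h1 one_ne_zero

theorem exists_equiv_of_range_eq {f : A →⋆ₐ[ℂ] C} (hf : Function.Injective f)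
    {B : StarSubalgebra ℂ C} (h : f.range = B) : ∃ e : A ≃⋆ₐ[ℂ] B, ∀ x, (e x : C) = f x := by
  subst h
  exact ⟨StarAlgEquiv.ofInjective f hf, fun x =>
    congrArg Subtype.val (StarAlgEquiv.ofInjective_apply f hf x)⟩

theorem IsSimpleCStar.of_equiv {B : StarSubalgebra ℂ C} (hA : IsSimpleCStar A) (e : A ≃⋆ₐ[ℂ] B) :
    IsSimpleCStar B := by
  have he : Continuous e := by
    refine continuous_induced_rng.mpr ?_
    exact continuous_starAlgHom (B.subtype.comp (StarAlgHomClass.toStarAlgHom e))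
  obtain ⟨hn, hA⟩ := hA
  refine ⟨(EquivLike.injective e).nontrivial, fun I hI => ?_⟩
  have hmem : ∀ x, x ∈ I.comap e ↔ e x ∈ I := fun x => TwoSidedIdeal.mem_comap e
  have hset : (I.comap e : Set A) = e ⁻¹' I := Set.ext hmem
  rcases hA (I.comap e) (hset ▸ hI.preimage he) with h | h
  · left
    refine le_antisymm (fun y hy => ?_) bot_le
    have h1 : e.symm y ∈ I.comap e := (hmem _).mpr (by rwa [e.apply_symm_apply])
    rw [h, TwoSidedIdeal.mem_bot] at h1
    rw [TwoSidedIdeal.mem_bot, ← e.apply_symm_apply y, h1, map_zero]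
  · right
    refine (TwoSidedIdeal.one_mem_iff I).mp ?_
    have h1 : (1 : A) ∈ I.comap e := h ▸ trivial
    rwa [hmem, map_one] at h1

open scoped ComplexOrder in
theorem IsTrace.comp_equiv {A C : Type*} [Ring A] [StarRing A] [Algebra ℂ A] [Ring C] [StarRing C]
    [Algebra ℂ C] {τ : C →ₗ[ℂ] ℂ} (h : IsTrace τ) (e : A ≃⋆ₐ[ℂ] C) :
    IsTrace (τ ∘ₗ (e.toAlgEquiv : A ≃ₐ[ℂ] C).toLinearMap) where
  map_one := by
    change τ (e 1) = 1
    rw [_root_.map_one e, h.map_one]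
  nonneg x := by
    change 0 ≤ τ (e (star x * x))
    rw [map_mul, map_star]
    exact h.nonneg _
  comm x y := by
    change τ (e (x * y)) = τ (e (y * x))
    rw [map_mul e, map_mul e, h.comm]

theorem existsUnique_trace_of_equiv {A C : Type*} [Ring A] [StarRing A] [Algebra ℂ A] [Ring C]
    [StarRing C] [Algebra ℂ C] (hA : ∃! τ : A →ₗ[ℂ] ℂ, IsTrace τ) (e : A ≃⋆ₐ[ℂ] C) :
    ∃! τ : C →ₗ[ℂ] ℂ, IsTrace τ := by
  obtain ⟨τ, hτ, huniq⟩ := hA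
  refine ⟨_, hτ.comp_equiv e.symm, fun σ hσ => LinearMap.ext fun y => ?_⟩
  have := LinearMap.congr_fun (huniq _ (hσ.comp_equiv e)) (e.symm y)
  change σ (e (e.symm y)) = τ (e.symm y) at this
  rw [e.apply_symm_apply] at this
  exact this

/-- By Stone–Weierstrass the range is dense, and as the range of an isometry it is closed. -/
theorem surjective_of_separatesPoints {X : Type*} [TopologicalSpace X] [CompactSpace X]
    {f : A →⋆ₐ[ℂ] C(X, ℂ)} (hf : Function.Injective f)
    (h : ∀ x y, x ≠ y → ∃ a, f a x ≠ f a y) : Function.Surjective f := by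
  have hsep : f.range.SeparatesPoints := fun x y hxy => by
    obtain ⟨a, ha⟩ := h x y hxy
    exact ⟨f a, ⟨f a, ⟨a, rfl⟩, rfl⟩, ha⟩
  have h1 := ContinuousMap.starSubalgebra_topologicalClosure_eq_top_of_separatesPoints _ hsep
  intro g
  have h2 : g ∈ f.range.topologicalClosure := h1 ▸ StarSubalgebra.mem_top
  exact StarSubalgebra.topologicalClosure_minimal le_rfl (isClosed_range_of_injective hf) h2

end General

variable {G : Type*} [CommGroup G] [TopologicalSpace G] [DiscreteTopology G] (φ : G →* G)

/-! ## The isomorphism `C*(G) ≅ C(H)` -/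

/-- `g ↦ ⟨g | ·⟩` as a unitary representation. -/
def evalCharHom (G : Type*) [CommGroup G] [TopologicalSpace G] [DiscreteTopology G] :
    G →* unitary C(PontryaginDual G, ℂ) where
  toFun g := ⟨evalChar g, by
    have h : ∀ χ, star (evalChar g χ) * evalChar g χ = 1 := fun χ => by
      change star (χ g : ℂ) * χ g = 1
      rw [Complex.star_def, ← Circle.coe_inv_eq_conj, ← Circle.coe_mul, inv_mul_cancel,
        Circle.coe_one]
    exact ⟨ContinuousMap.ext h, ContinuousMap.ext fun k => (mul_comm _ _).trans (h k)⟩⟩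
  map_one' := Subtype.ext (ContinuousMap.ext fun χ => by
    change ((χ 1 : Circle) : ℂ) = 1
    rw [map_one, Circle.coe_one])
  map_mul' g h := Subtype.ext (ContinuousMap.ext fun χ => by
    change ((χ (g * h) : Circle) : ℂ) = χ g * χ h
    rw [map_mul, Circle.coe_mul])

/-- Every one-dimensional representation of `C*(G)` is evaluation at a point of `H`, which gives
injectivity; surjectivity holds because the functions `evalChar g` separate points. -/
theorem exists_equiv_dual : ∃ e : GroupCStar G ≃⋆ₐ[ℂ] C(PontryaginDual G, ℂ),
    ∀ g, e (GroupCStar.delta g) = evalChar g := by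
  let f := GroupCStar.liftHom (evalCharHom G)
  have hf : ∀ g, f (GroupCStar.delta g) = evalChar g := GroupCStar.liftHom_delta _
  have hinj : Function.Injective f := by
    rw [injective_iff_map_eq_zero]
    intro x hx
    refine GroupCStar.eq_zero_of_forall_char fun σ => ?_
    let χ : PontryaginDual G := ⟨GroupCStar.charOf σ, continuous_of_discreteTopology⟩
    have : σ = (ContinuousMap.evalStarAlgHom ℂ ℂ χ).comp f := GroupCStar.hom_ext fun g => by
      change σ (GroupCStar.delta g) = f (GroupCStar.delta g) χ
      rw [hf]; rfl
    have h2 : σ x = f x χ := DFunLike.congr_fun this x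
    rw [h2, hx]; rfl
  have hsurj : Function.Surjective f := surjective_of_separatesPoints hinj fun χ ψ hne => by
    obtain ⟨g, hg⟩ : ∃ g, χ g ≠ ψ g := by
      by_contra! h
      exact hne (PontryaginDual.ext h)
    refine ⟨GroupCStar.delta g, fun h => hg (Circle.ext ?_)⟩
    rw [hf] at h
    exact h
  exact ⟨StarAlgEquiv.ofBijective f ⟨hinj, hsurj⟩, hf⟩

/-! ## The structure of `B_φ` -/

section Structure

variable [Finite (G ⧸ φ.range)]

theorem cosetIndicator_apply (n : ℕ) (g : G) (k : adicCompletion φ) : cosetIndicator φ n g k =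
    Set.indicator {(g : G ⧸ powRange φ n)} (fun _ => (1 : ℂ)) (k.1 n) := rfl

theorem conjCharFun_eq_sum (l : kerUnion φ) [Fintype (G ⧸ powRange φ (level l))] :
    conjCharFun l = ∑ x : G ⧸ powRange φ (level l),
      (((l.1 x.out)⁻¹ : Circle) : ℂ) • cosetIndicator φ (level l) x.out := by
  ext k
  have h1 : ∀ x : G ⧸ powRange φ (level l),
      cosetIndicator φ (level l) x.out k = Set.indicator {x} (fun _ => (1 : ℂ)) (k.1 (level l)) :=
    fun x => by rw [cosetIndicator_apply, QuotientGroup.out_eq']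
  rw [ContinuousMap.sum_apply, Finset.sum_eq_single (k.1 (level l))]
  · rw [ContinuousMap.smul_apply, h1, Set.indicator_of_mem (Set.mem_singleton _), smul_eq_mul, mul_one]
    rfl
  · intro x _ hx
    rw [ContinuousMap.smul_apply, h1,
      Set.indicator_of_notMem (fun h => hx (Set.mem_singleton_iff.mp h).symm), smul_zero]
  · simp

/-- Conjugation by `u_g` moves the projection of a coset `x` to that of `gx`. Since `f_l` is a
finite combination of coset indicators, reindexing by `g` produces the factor `⟨g | l⟩`. -/
theorem uGen_mul_homCK_conjChar (g : G) (l : kerUnion φ) :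
    uGen φ g * homCK φ (conjCharFun l) =
      (pairing φ g l : ℂ) • (homCK φ (conjCharFun l) * uGen φ g) := by
  have := Fintype.ofFinite (G ⧸ powRange φ (level l))
  have htriv := fun x => apply_eq_one_of_mem_powRange_level (g := x) l
  rw [conjCharFun_eq_sum]
  simp only [map_sum, map_smul, homCK_cosetIndicator]
  rw [Finset.mul_sum, Finset.sum_mul, Finset.smul_sum]
  refine Fintype.sum_equiv (Equiv.mulLeft (g : G ⧸ powRange φ (level l))) _ _ fun x => ?_
  set y : G ⧸ powRange φ (level l) := Equiv.mulLeft (g : G ⧸ powRange φ (level l)) x with hy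
  have hxy : ((g * x.out : G) : G ⧸ powRange φ (level l)) = (y.out : G) := by
    rw [QuotientGroup.out_eq', QuotientGroup.mk_mul, QuotientGroup.out_eq']; rfl
  rw [← apply_eq_of_mk_eq htriv hxy, ← proj_congr φ hxy, mul_smul_comm, smul_mul_assoc, smul_smul]
  congr 1
  · rw [map_mul, mul_inv, Circle.coe_mul, ← mul_assoc, ← Circle.coe_mul]
    have : pairing φ g l * (l.1 g)⁻¹ = 1 := mul_inv_cancel (l.1 g)
    rw [this, Circle.coe_one, one_mul]
  · simp only [proj_eq, uGen_mul, mul_inv_rev]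
    have : uGen φ g⁻¹ * uGen φ g = 1 := by rw [← uGen_mul, inv_mul_cancel, uGen_one]
    simp only [mul_assoc, this, mul_one]

/-- This is where the triviality of `⋂ φⁿ(G)` enters. -/
theorem pairing_nondegenerate_left (hexact : ⨅ n, powRange φ n = ⊥) (g : G)
    (h : ∀ l, pairing φ g l = 1) : g = 1 := by
  by_contra hg
  obtain ⟨n, hn⟩ : ∃ n, g ∉ powRange φ n := by
    by_contra! hn
    have : g ∈ ⨅ n, powRange φ n := Subgroup.mem_iInf.mpr hn
    rw [hexact] at this
    exact hg this
  obtain ⟨l, -, hl⟩ := exists_kerUnion_apply_ne_one hn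
  exact hl (h l)

theorem pairing_nondegenerate_right (l : kerUnion φ) (h : ∀ g, pairing φ g l = 1) : l = 1 :=
  Subtype.ext (PontryaginDual.ext h)

/-- The homomorphism `C*(L) → C(K)`. -/
def homLK : GroupCStar (kerUnion φ) →⋆ₐ[ℂ] C(adicCompletion φ, ℂ) :=
  GroupCStar.liftHom (conjCharHom φ)

theorem homLK_delta (l : kerUnion φ) : homLK φ (GroupCStar.delta l) = conjCharFun l :=
  GroupCStar.liftHom_delta _ _

/-- The homomorphism `C*(L) ⋊ G → A_φ`. -/
def homB : DualCrossedProduct (pairing φ) →⋆ₐ[ℂ] EndoAlgebra φ :=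
  CrossedProduct.liftHom ((homCK φ).comp (homLK φ)) (uGenHom φ)
    (DualCrossedProduct.covariant_of_delta _ _ fun g l => by
      change uGen φ g * homCK φ (homLK φ _) = _ • (homCK φ (homLK φ _) * uGen φ g)
      rw [homLK_delta, uGen_mul_homCK_conjChar])

theorem homB_coeff (x : GroupCStar (kerUnion φ)) :
    homB φ (CrossedProduct.coeff _ x) = homCK φ (homLK φ x) :=
  CrossedProduct.liftHom_coeff _ _ _ x

theorem homB_grp (g : G) : homB φ (CrossedProduct.grp _ g) = uGen φ g :=
  CrossedProduct.liftHom_grp _ _ _ g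

/-! ### Injectivity and ranges of the canonical maps -/

variable {φ} (hinj : Function.Injective φ) (hexact : ⨅ n, powRange φ n = ⊥)

include hinj in
theorem nontrivial_dualCrossedProduct : Nontrivial (DualCrossedProduct (pairing φ)) :=
  have := nontrivial_endoAlgebra φ hinj
  RingHom.domain_nontrivial (homB φ : _ →+* EndoAlgebra φ)

include hinj hexact

theorem isSimple_dualCrossedProduct : IsSimpleCStar (DualCrossedProduct (pairing φ)) ∧
    ∃! τ : DualCrossedProduct (pairing φ) →ₗ[ℂ] ℂ, IsTrace τ :=
  have := nontrivial_dualCrossedProduct hinj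
  DualCrossedProduct.isSimple_and_existsUnique_trace _
    (pairing_nondegenerate_left φ hexact) (pairing_nondegenerate_right φ)

/-- Simplicity makes every unital homomorphism into a nonzero algebra faithful. -/
theorem injective_homB : Function.Injective (homB φ) :=
  have := nontrivial_endoAlgebra φ hinj
  injective_of_isSimpleCStar (isSimple_dualCrossedProduct hinj hexact).1 _

theorem injective_homCK_comp_homLK : Function.Injective ((homCK φ).comp (homLK φ)) := by
  have := nontrivial_dualCrossedProduct hinj
  have h : (homCK φ).comp (homLK φ) = (homB φ).comp (CrossedProduct.coeffHom _) :=
    StarAlgHom.ext fun x => (homB_coeff φ x).symm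
  rw [h]
  exact (injective_homB hinj hexact).comp (DualCrossedProduct.injective_coeff _)

/-- Injective because its composite with `homCK φ` is, and surjective because the functions `f_l`
separate the points of `K`. -/
theorem bijective_homLK : Function.Bijective (homLK φ) := by
  have hi : Function.Injective (homLK φ) :=
    Function.Injective.of_comp (f := homCK φ) (injective_homCK_comp_homLK hinj hexact)
  refine ⟨hi, surjective_of_separatesPoints hi fun k k' hne => ?_⟩
  obtain ⟨l, hl⟩ := exists_conjChar_ne hne
  refine ⟨GroupCStar.delta l, fun h => hl (Circle.ext ?_)⟩
  rw [homLK_delta] at h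
  exact h

/-- All functions on `K` come from `C*(L)`, where the composite is already known to be injective. -/
theorem injective_homCK : Function.Injective (homCK φ) := by
  intro f f' h
  obtain ⟨x, rfl⟩ := (bijective_homLK hinj hexact).2 f
  obtain ⟨y, rfl⟩ := (bijective_homLK hinj hexact).2 f'
  rw [injective_homCK_comp_homLK hinj hexact h]

/-- The map factors through `C*(L) ⋊ G`, where characters of `G` twist the `u_g`, followed by the
injective `homB φ`. -/
theorem injective_liftHom_uGen : Function.Injective (GroupCStar.liftHom (uGenHom φ)) := by
  have := nontrivial_dualCrossedProduct hinj
  have h : GroupCStar.liftHom (uGenHom φ) =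
      (homB φ).comp (GroupCStar.liftHom (DualCrossedProduct.uHom (pairing φ))) :=
    GroupCStar.hom_ext fun g => by
      change _ = homB φ (GroupCStar.liftHom _ _)
      rw [GroupCStar.liftHom_delta, GroupCStar.liftHom_delta]
      exact (homB_grp φ g).symm
  rw [h]
  exact (injective_homB hinj hexact).comp (DualCrossedProduct.injective_liftHom_u _)

theorem range_homCK : (homCK φ).range = subalgCK φ := by
  refine le_antisymm ?_ (cstarGen_le (isClosed_range_of_injective (injective_homCK hinj hexact)) ?_)
  · rintro _ ⟨f, rfl⟩
    exact homCK_mem φ f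
  · rintro _ ⟨⟨n, g⟩, rfl⟩
    exact ⟨_, homCK_cosetIndicator φ n g⟩

theorem range_liftHom_uGen : (GroupCStar.liftHom (uGenHom φ)).range = subalgCH φ := by
  refine le_antisymm ?_
    (cstarGen_le (isClosed_range_of_injective (injective_liftHom_uGen hinj hexact)) ?_)
  · rintro _ ⟨x, rfl⟩
    have := GroupCStar.eq_top_of_delta_mem ((subalgCH φ).comap (GroupCStar.liftHom (uGenHom φ)))
      ((isClosed_cstarGen _).preimage (continuous_starAlgHom (GroupCStar.liftHom (uGenHom φ))))
      (fun g => by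
        change GroupCStar.liftHom (uGenHom φ) _ ∈ subalgCH φ
        rw [GroupCStar.liftHom_delta]
        exact subset_cstarGen _ ⟨g, rfl⟩)
    have h2 : x ∈ (subalgCH φ).comap (GroupCStar.liftHom (uGenHom φ)) :=
      this ▸ StarSubalgebra.mem_top
    exact h2
  · rintro _ ⟨g, rfl⟩
    exact ⟨_, GroupCStar.liftHom_delta _ g⟩

theorem range_homCK_comp_homLK : ((homCK φ).comp (homLK φ)).range = subalgCK φ := by
  rw [← range_homCK hinj hexact]
  refine le_antisymm ?_ ?_
  · rintro _ ⟨x, rfl⟩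
    exact ⟨homLK φ x, rfl⟩
  · rintro _ ⟨f, rfl⟩
    obtain ⟨x, rfl⟩ := (bijective_homLK hinj hexact).2 f
    exact ⟨x, rfl⟩

theorem range_homB : (homB φ).range = subalgB φ := by
  refine le_antisymm ?_ (cstarGen_le (isClosed_range_of_injective (injective_homB hinj hexact)) ?_)
  · rintro _ ⟨x, rfl⟩
    have := CrossedProduct.eq_top_of_mem ((subalgB φ).comap (homB φ))
      ((isClosed_cstarGen _).preimage (continuous_starAlgHom (homB φ)))
      (fun a => by
        change homB φ _ ∈ subalgB φ
        rw [homB_coeff]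
        exact subset_cstarGen _ (Or.inr (homCK_mem φ _)))
      (fun g => by
        change homB φ _ ∈ subalgB φ
        rw [homB_grp]
        exact subset_cstarGen _ (Or.inl (subset_cstarGen _ ⟨g, rfl⟩)))
    have h2 : x ∈ (subalgB φ).comap (homB φ) := this ▸ StarSubalgebra.mem_top
    exact h2
  · refine Set.union_subset ?_ ?_
    · refine cstarGen_le (isClosed_range_of_injective (injective_homB hinj hexact)) ?_
      rintro _ ⟨g, rfl⟩
      exact ⟨_, homB_grp φ g⟩
    · rw [← range_homCK_comp_homLK hinj hexact]
      rintro _ ⟨x, rfl⟩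
      exact ⟨_, homB_coeff φ x⟩

/-! ## The crossed product decompositions -/

theorem exists_crossedProduct_cstarL : ∃ Φ : DualCrossedProduct (pairing φ) ≃⋆ₐ[ℂ] subalgB φ,
    (∀ x, (Φ (CrossedProduct.coeff _ x) : EndoAlgebra φ) = homCK φ (homLK φ x)) ∧
      ∀ g, (Φ (CrossedProduct.grp _ g) : EndoAlgebra φ) = uGen φ g := by
  obtain ⟨Φ, hΦ⟩ := exists_equiv_of_range_eq (injective_homB hinj hexact) (range_homB hinj hexact)
  exact ⟨Φ, fun x => (hΦ _).trans (homB_coeff φ x), fun g => (hΦ _).trans (homB_grp φ g)⟩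

/-- `C*(L) ≅ C(K)` is equivariant because `f_l` is multiplicative on `K`: `f_l(g⁻¹k) = ⟨g | l⟩
f_l(k)`. -/
theorem exists_crossedProduct_CK :
    ∃ Φ : CrossedProduct ((translation (adicCompletion φ)).comp (toCompletion φ)) ≃⋆ₐ[ℂ] subalgB φ,
      (∀ f, (Φ (CrossedProduct.coeff _ f) : EndoAlgebra φ) = homCK φ f) ∧
        ∀ g, (Φ (CrossedProduct.grp _ g) : EndoAlgebra φ) = uGen φ g := by
  obtain ⟨Φ, hc, hg⟩ := exists_crossedProduct_cstarL hinj hexact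
  let e : GroupCStar (kerUnion φ) ≃⋆ₐ[ℂ] C(adicCompletion φ, ℂ) :=
    StarAlgEquiv.ofBijective (homLK φ) (bijective_homLK hinj hexact)
  have he : ∀ f, homLK φ (e.symm f) = f := e.apply_symm_apply
  have hequiv : ∀ g, (homLK φ).comp (GroupCStar.dualAction (pairing φ g)) =
      (translation (adicCompletion φ) (toCompletion φ g)).comp (homLK φ) := fun g =>
    GroupCStar.hom_ext fun l => by
      change homLK φ (GroupCStar.dualAction (pairing φ g) (GroupCStar.delta l)) =
        translation (adicCompletion φ) (toCompletion φ g) (homLK φ (GroupCStar.delta l))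
      rw [GroupCStar.dualAction_delta, map_smul, homLK_delta]
      ext k
      change (pairing φ g l : ℂ) * conjChar l k = conjChar l ((toCompletion φ g)⁻¹ * k)
      rw [conjChar_mul_right, ← map_inv, conjChar_toCompletion, Circle.coe_mul]
      simp
  obtain ⟨E, hE, hE'⟩ := CrossedProduct.exists_equiv
    (β := (translation (adicCompletion φ)).comp (toCompletion φ))
    (β' := GroupCStar.dualAction.comp (pairing φ)) e.symm (fun g f => by
      have h : homLK φ (GroupCStar.dualAction (pairing φ g) (e.symm f)) =
        translation (adicCompletion φ) (toCompletion φ g) (homLK φ (e.symm f)) :=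
        DFunLike.congr_fun (hequiv g) (e.symm f)
      apply (bijective_homLK hinj hexact).1
      rw [he] at h
      rw [he]
      exact h.symm)
  refine ⟨E.trans Φ, fun f => ?_, fun g => ?_⟩
  · exact (congrArg (fun z => (Φ z : EndoAlgebra φ)) (hE f)).trans
      ((hc _).trans (congrArg (homCK φ) (he f)))
  · exact (congrArg (fun z => (Φ z : EndoAlgebra φ)) (hE' g)).trans (hg g)

/-- The relation `u_g w_l = ⟨g | l⟩ w_l u_g` can equally be read as an action of `L` on the `u_g`,
with the inverse pairing. -/
theorem exists_crossedProduct_cstarG :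
    ∃ Φ : DualCrossedProduct (pairing φ).flip⁻¹ ≃⋆ₐ[ℂ] subalgB φ,
      (∀ x, (Φ (CrossedProduct.coeff _ x) : EndoAlgebra φ) =
        GroupCStar.liftHom (uGenHom φ) x) ∧
      ∀ l, (Φ (CrossedProduct.grp _ l) : EndoAlgebra φ) =
        homCK φ (homLK φ (GroupCStar.delta l)) := by
  obtain ⟨Φ, hc, hg⟩ := exists_crossedProduct_cstarL hinj hexact
  obtain ⟨F, hF, hF'⟩ := DualCrossedProduct.exists_flip (pairing φ)
  refine ⟨F.trans Φ, fun x => ?_, fun l => ?_⟩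
  · let f : DualCrossedProduct (pairing φ).flip⁻¹ →⋆ₐ[ℂ] EndoAlgebra φ :=
      (subalgB φ).subtype.comp (StarAlgHomClass.toStarAlgHom (F.trans Φ))
    have h : f.comp (CrossedProduct.coeffHom _) = GroupCStar.liftHom (uGenHom φ) :=
      GroupCStar.hom_ext fun g => by
        rw [GroupCStar.liftHom_delta]
        exact (congrArg (fun z => (Φ z : EndoAlgebra φ)) (hF' g)).trans (hg g)
    exact DFunLike.congr_fun h x
  · exact (congrArg (fun z => (Φ z : EndoAlgebra φ)) (hF l)).trans (hc _)

/-- Translation by `l` multiplies `evalChar g` by `⟨g | l⟩⁻¹`, so `e` intertwines the two actions of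
`L`. -/
theorem exists_crossedProduct_CH (e : GroupCStar G ≃⋆ₐ[ℂ] C(PontryaginDual G, ℂ))
    (he : ∀ g, e (GroupCStar.delta g) = evalChar g) :
    ∃ Φ : CrossedProduct ((translation (PontryaginDual G)).comp (kerUnion φ).subtype)
        ≃⋆ₐ[ℂ] subalgB φ,
      (∀ f, (Φ (CrossedProduct.coeff _ f) : EndoAlgebra φ) =
        GroupCStar.liftHom (uGenHom φ) (e.symm f)) ∧
      ∀ l, (Φ (CrossedProduct.grp _ l) : EndoAlgebra φ) =
        homCK φ (homLK φ (GroupCStar.delta l)) := by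
  obtain ⟨Φ, hc, hg⟩ := exists_crossedProduct_cstarG hinj hexact
  let e' : GroupCStar G →⋆ₐ[ℂ] C(PontryaginDual G, ℂ) := StarAlgHomClass.toStarAlgHom e
  have hequiv : ∀ l : kerUnion φ, e'.comp (GroupCStar.dualAction ((pairing φ).flip⁻¹ l)) =
      (translation (PontryaginDual G) l).comp e' := fun l =>
    GroupCStar.hom_ext fun g => by
      change e (GroupCStar.dualAction ((pairing φ).flip⁻¹ l) (GroupCStar.delta g)) =
        translation (PontryaginDual G) l (e (GroupCStar.delta g))
      rw [GroupCStar.dualAction_delta, map_smul, he]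
      ext χ
      change (((l.1 g)⁻¹ : Circle) : ℂ) * (χ g : ℂ) = (((l.1 g)⁻¹ * χ g : Circle) : ℂ)
      rw [Circle.coe_mul]
  obtain ⟨E, hE, hE'⟩ := CrossedProduct.exists_equiv
    (β := (translation (PontryaginDual G)).comp (kerUnion φ).subtype)
    (β' := GroupCStar.dualAction.comp (pairing φ).flip⁻¹) e.symm (fun l f => by
      have h : e (GroupCStar.dualAction ((pairing φ).flip⁻¹ l) (e.symm f)) =
        translation (PontryaginDual G) l (e (e.symm f)) :=
        DFunLike.congr_fun (hequiv l) (e.symm f)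
      apply EquivLike.injective e
      rw [e.apply_symm_apply] at h
      rw [e.apply_symm_apply]
      exact h.symm)
  refine ⟨E.trans Φ, fun f => ?_, fun l => ?_⟩
  · exact (congrArg (fun z => (Φ z : EndoAlgebra φ)) (hE f)).trans (hc _)
  · exact (congrArg (fun z => (Φ z : EndoAlgebra φ)) (hE' l)).trans (hg l)

end Structure

end

end

end EndoAlg

open EndoAlg

theorem mainTheorem8 {G : Type*} [CommGroup G] [Countable G] [TopologicalSpace G]
    [DiscreteTopology G] (φ : G →* G) (hinj : Function.Injective φ)
    [Finite (G ⧸ φ.range)] (hcoker : 1 < Nat.card (G ⧸ φ.range))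
    (hexact : ⨅ n, powRange φ n = ⊥) :
    -- the canonical embeddings of `C(H)`, `C(K)`, `C*(G)`, `C*(L)` into `A_φ`
    ∃ (jH : C(PontryaginDual G, ℂ) →⋆ₐ[ℂ] EndoAlgebra φ)
      (jK : C(adicCompletion φ, ℂ) →⋆ₐ[ℂ] EndoAlgebra φ)
      (jG : GroupCStar G →⋆ₐ[ℂ] EndoAlgebra φ)
      (jL : GroupCStar (kerUnion φ) →⋆ₐ[ℂ] EndoAlgebra φ),
      (Function.Injective jH ∧ (∀ g, jH (evalChar g) = uGen φ g) ∧
        jH.range = subalgCH φ) ∧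
      (Function.Injective jK ∧ (∀ n g, jK (cosetIndicator φ n g) = proj φ n g) ∧
        jK.range = subalgCK φ) ∧
      (Function.Injective jG ∧ (∀ g, jG (GroupCStar.delta g) = uGen φ g) ∧
        jG.range = subalgCH φ) ∧
      -- `w_l` is the function `k ↦ ⟨k | l⟩⁻¹` on `K`, so that `u_g w_l = ⟨g | l⟩ w_l u_g`
      (Function.Injective jL ∧
        (∀ l : kerUnion φ, ∃ f : C(adicCompletion φ, ℂ),
          (∀ g, f (toCompletion φ g) = ((pairing φ g l)⁻¹ : Circle)) ∧
          jL (GroupCStar.delta l) = jK f) ∧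
        jL.range = subalgCK φ) ∧
      -- `B_φ` is generated by `C(H)` and `C(K)`, equivalently by `C*(G)` and `C*(L)`
      subalgB φ = cstarGen (Set.range jH ∪ Set.range jK) ∧
      subalgB φ = cstarGen (Set.range jG ∪ Set.range jL) ∧
      -- `B_φ ≅ C(K) ⋊ G`
      (∃ Φ : CrossedProduct ((translation (adicCompletion φ)).comp (toCompletion φ))
          ≃⋆ₐ[ℂ] subalgB φ,
        (∀ f, (Φ (CrossedProduct.coeff _ f) : EndoAlgebra φ) = jK f) ∧
        ∀ g, (Φ (CrossedProduct.grp _ g) : EndoAlgebra φ) = uGen φ g) ∧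
      -- `B_φ` is simple with a unique trace
      IsSimpleCStar (subalgB φ) ∧
      (∃! τ : subalgB φ →ₗ[ℂ] ℂ, IsTrace τ) ∧
      -- `B_φ ≅ C*(L) ⋊ G`
      (∃ Φ : CrossedProduct (actionOnCStarL φ) ≃⋆ₐ[ℂ] subalgB φ,
        (∀ x, (Φ (CrossedProduct.coeff _ x) : EndoAlgebra φ) = jL x) ∧
        ∀ g, (Φ (CrossedProduct.grp _ g) : EndoAlgebra φ) = uGen φ g) ∧
      -- `B_φ ≅ C*(G) ⋊ L`
      (∃ Φ : CrossedProduct (actionOnCStarG φ) ≃⋆ₐ[ℂ] subalgB φ,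
        (∀ x, (Φ (CrossedProduct.coeff _ x) : EndoAlgebra φ) = jG x) ∧
        ∀ l, (Φ (CrossedProduct.grp _ l) : EndoAlgebra φ) = jL (GroupCStar.delta l)) ∧
      -- `B_φ ≅ C(H) ⋊ L`
      (∃ Φ : CrossedProduct ((translation (PontryaginDual G)).comp (kerUnion φ).subtype)
          ≃⋆ₐ[ℂ] subalgB φ,
        (∀ f, (Φ (CrossedProduct.coeff _ f) : EndoAlgebra φ) = jH f) ∧
        ∀ l, (Φ (CrossedProduct.grp _ l) : EndoAlgebra φ) = jL (GroupCStar.delta l)) := by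
  obtain ⟨e, he⟩ := exists_equiv_dual (G := G)
  have hjG : ∀ g, GroupCStar.liftHom (uGenHom φ) (GroupCStar.delta g) = uGen φ g :=
    GroupCStar.liftHom_delta _
  have hjGrange := range_liftHom_uGen hinj hexact
  have hjLrange := range_homCK_comp_homLK hinj hexact
  have hjKrange := range_homCK hinj hexact
  let jH : C(PontryaginDual G, ℂ) →⋆ₐ[ℂ] EndoAlgebra φ :=
    (GroupCStar.liftHom (uGenHom φ)).comp (StarAlgHomClass.toStarAlgHom e.symm)
  have hjH : ∀ f, jH f = GroupCStar.liftHom (uGenHom φ) (e.symm f) := fun _ => rfl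
  have hjHrange : jH.range = subalgCH φ := by
    rw [← hjGrange]
    refine le_antisymm ?_ ?_
    · rintro _ ⟨f, rfl⟩
      exact ⟨e.symm f, rfl⟩
    · rintro _ ⟨x, rfl⟩
      exact ⟨e x, congrArg (GroupCStar.liftHom (uGenHom φ)) (e.symm_apply_apply x)⟩
  obtain ⟨hsimple, htrace⟩ := isSimple_dualCrossedProduct hinj hexact
  obtain ⟨Φ, hc, hg⟩ := exists_crossedProduct_cstarL hinj hexact
  -- Taking `jL` to be the composite through `C(K)` makes `w_l = jK f_l` immediate.
  refine ⟨jH, homCK φ, GroupCStar.liftHom (uGenHom φ), (homCK φ).comp (homLK φ),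
    ⟨(injective_liftHom_uGen hinj hexact).comp (EquivLike.injective e.symm), fun g => ?_,
      hjHrange⟩,
    ⟨injective_homCK hinj hexact, homCK_cosetIndicator φ, hjKrange⟩,
    ⟨injective_liftHom_uGen hinj hexact, hjG, hjGrange⟩,
    ⟨injective_homCK_comp_homLK hinj hexact, fun l => ⟨conjCharFun l, fun g => ?_, ?_⟩, hjLrange⟩,
    ?_, ?_, exists_crossedProduct_CK hinj hexact, hsimple.of_equiv Φ,
    existsUnique_trace_of_equiv htrace Φ, ⟨Φ, hc, hg⟩, exists_crossedProduct_cstarG hinj hexact,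
    exists_crossedProduct_CH hinj hexact e he⟩
  · rw [hjH, ← he, e.symm_apply_apply, hjG]
  · exact congrArg (fun z : Circle => (z : ℂ)) (conjChar_toCompletion l g)
  · exact congrArg (homCK φ) (homLK_delta φ l)
  -- `subalgB φ` is by definition generated by the two subalgebras that these ranges equal.
  · rw [← coe_range_starAlgHom, ← coe_range_starAlgHom, hjHrange, hjKrange]; rfl
  · rw [← coe_range_starAlgHom, ← coe_range_starAlgHom, hjGrange, hjLrange]; rfl
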